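/- Let $R$ be a Cohen–Macaulay (commutative, Noetherian) local ring with canonical module $\omega_R$, that is, a maximal Cohen–Macaulay module of type $1$ and of finite injective dimension; here a finitely generated $R$-module is called maximal Cohen–Macaulay if its depth equals $\dim R$, with the convention $\operatorname{depth} 0=+\infty$ (so the zero module is not maximal Cohen–Macaulay). For an $R$-module $X$ write $X^\vee=\operatorname{Hom}_R(X,\omega_R)$. Let $M$ and $N$ be finitely generated $R$-modules, with $N$ maximal Cohen–Macaulay, and let $n\ge 1$ be an integer. Suppose that for each $j=0,\dots,n-1$ the $R$-module $\operatorname{Tor}_j^R(M,N^\vee)$ is either zero or maximal Cohen–Macaulay. Then there are isomorphisms of $R$-modules $$\operatorname{Ext}^j_R(M,N)\cong \operatorname{Tor}_j^R(M,N^\vee)^\vee\qquad\text{for all } j=0,\dots,n.$$ In particular, $\operatorname{Ext}^j_R(M,N)^\vee\cong\operatorname{Tor}_j^R(M,N^\vee)$ for all $j=0,\dots,n-1$. There is also an exact sequence of $R$-modules $$0\to \operatorname{Ext}^1_R(\operatorname{Tor}_n^R(M,N^\vee),\omega_R)\to \operatorname{Ext}^{n+1}_R(M,N)\to \operatorname{Tor}_{n+1}^R(M,N^\vee)^\vee\to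 \operatorname{Ext}^2_R(\operatorname{Tor}_n^R(M,N^\vee),\omega_R)\to \operatorname{Ext}^{n+2}_R(M,N).$$ -/

import Mathlib

open CategoryTheory

universe u

noncomputable section

namespace CanonicalDuality

/-- The module `Ext^j_R(M, N)`: Mathlib's `Ext` in the category of `R`-modules, which carries
its `R`-module structure. -/
abbrev ExtMod (R : Type u) [CommRing R] (M N : Type u) [AddCommGroup M] [Module R M]
    [AddCommGroup N] [Module R N] (j : ℕ) : Type u :=
  Abelian.Ext.{u} (ModuleCat.of R M) (ModuleCat.of R N) j

/-- The module `Tor_j^R(M, N)`: the value at `M` of the `j`-th left derived functor of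
`- ⊗ N`, that is, the `j`-th homology of `F ⊗ N` for a projective resolution `F` of `M`. -/
abbrev TorMod (R : Type u) [CommRing R] (M N : Type u) [AddCommGroup M] [Module R M]
    [AddCommGroup N] [Module R N] (j : ℕ) : ModuleCat.{u} R :=
  ((Tor' (ModuleCat.{u} R) j).obj (ModuleCat.of R M)).obj (ModuleCat.of R N)

variable (R : Type u) [CommRing R] [IsLocalRing R]

/-- The depth of a module over a local ring with maximal ideal `m`: the supremum of the lengths
of the weakly regular sequences on `M` with entries in `m`. For `M` finite and non-zero, such
a sequence is automatically regular (`M ≠ (r₁, …, rₖ)M` by Nakayama), so this is the usual depth;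
for `M = 0` every sequence counts and the depth is `⊤`. -/
def depth (M : Type u) [AddCommGroup M] [Module R M] : ℕ∞ :=
  ⨆ (rs : List R) (_ : ∀ r ∈ rs, r ∈ IsLocalRing.maximalIdeal R)
    (_ : RingTheory.Sequence.IsWeaklyRegular M rs), (rs.length : ℕ∞)

/-- A maximal Cohen-Macaulay module over a local ring: a finite module whose depth is the Krull
dimension of the ring. Over a Noetherian local ring the zero module (of depth `⊤`) is not
maximal Cohen-Macaulay. -/
structure IsMaximalCohenMacaulay (M : Type u) [AddCommGroup M] [Module R M] : Prop where
  finite : Module.Finite R M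
  depth_eq : (depth R M : WithBot ℕ∞) = ringKrullDim R

/-- A Cohen-Macaulay local ring: a Noetherian local ring whose depth is its Krull dimension. -/
structure IsCohenMacaulayLocalRing : Prop where
  noetherian : IsNoetherianRing R
  depth_eq : (depth R R : WithBot ℕ∞) = ringKrullDim R

/-- The type of a module `M` of finite depth `t` over a local ring with residue field `k`: the
`k`-dimension of `Ext^t_R(k, M)`. Since `Ext^t_R(k, M)` is killed by the maximal ideal,
its dimension over `k` is its length over `R`. -/
def moduleType (M : Type u) [AddCommGroup M] [Module R M] : ℕ∞ :=
  Module.length R (ExtMod R (IsLocalRing.ResidueField R) M (depth R M).toNat)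

/-- A canonical module of a Cohen-Macaulay local ring: a maximal Cohen-Macaulay module of type 1
and of finite injective dimension. -/
structure IsCanonicalModule (ω : Type u) [AddCommGroup ω] [Module R ω] : Prop where
  maximalCohenMacaulay : IsMaximalCohenMacaulay R ω
  type_eq_one : moduleType R ω = 1
  finite_injectiveDimension : ∃ d : ℕ, HasInjectiveDimensionLE (ModuleCat.of R ω) d

end CanonicalDuality

end

/-! Since `N` is isomorphic to its bidual, `Hom(F, N) ≃ Hom(F ⊗ N^∨, ω)` for a projective
resolution `F` of `M`. So `Ext(M, N)` is the cohomology of `Hom(K, ω)`, where the complex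
`K = F ⊗ N^∨` has homology `Tor(M, N^∨)` and `Hom(-, ω)`-acyclic terms. Splicing
`0 → H_(j+1)(K) → K_(j+1) / im K_(j+2) → K_j` with the cokernel `K_j / im K_(j+1)` gives a
five-term exact sequence for each `j`, and these cokernels are acyclic for as long as the modules
`Tor_j(M, N^∨)` are.

Acyclicity of maximal Cohen-Macaulay modules follows from Bass' bound on the injective dimension of
`ω`. Biduality is checked modulo a maximal `ω`-regular sequence `rs`: by Rees' theorem and since `ω`
has type 1, the functor `Hom(-, ω / rs ω)` preserves the length of modules of finite length killed
by `rs`, and therefore separates their points.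
-/

noncomputable section

namespace CanonicalDuality

open Abelian Function IsLocalRing Pointwise RingTheory.Sequence TensorProduct

section LongExactSequence

variable {R : Type u} [CommRing R] {X Y Z : Type u} [AddCommGroup X] [Module R X]
  [AddCommGroup Y] [Module R Y] [AddCommGroup Z] [Module R Z]
  (W : Type u) [AddCommGroup W] [Module R W]

/-- The map `Ext^k(Y, W) → Ext^k(X, W)` induced by a linear map `X → Y`. -/
def extMap (f : X →ₗ[R] Y) (k : ℕ) : ExtMod R Y W k →ₗ[R] ExtMod R X W k :=
  (Ext.mk₀ (ModuleCat.ofHom f)).precompOfLinear R (ModuleCat.of R W) (zero_add k)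

lemma extMap_apply (f : X →ₗ[R] Y) (k : ℕ) (x : ExtMod R Y W k) :
    extMap W f k x = (Ext.mk₀ (ModuleCat.ofHom f)).comp x (zero_add k) := rfl

lemma extMap_id (k : ℕ) : extMap W (LinearMap.id : X →ₗ[R] X) k = LinearMap.id := by
  ext x
  simp [extMap_apply]

lemma extMap_comp (f : X →ₗ[R] Y) (g : Y →ₗ[R] Z) (k : ℕ) :
    extMap W (g ∘ₗ f) k = extMap W f k ∘ₗ extMap W g k := by
  ext x
  rw [LinearMap.comp_apply, extMap_apply, extMap_apply, extMap_apply, ModuleCat.ofHom_comp,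
    Ext.mk₀_comp_mk₀_assoc]

lemma extMap_smul (r : R) (f : X →ₗ[R] Y) (k : ℕ) : extMap W (r • f) k = r • extMap W f k := by
  ext x
  have : ModuleCat.ofHom (r • f) = r • ModuleCat.ofHom f := rfl
  simp [extMap_apply, this, Ext.mk₀_smul]

lemma extMap_zero (k : ℕ) : extMap W (0 : X →ₗ[R] Y) k = 0 := by
  simpa only [zero_smul] using extMap_smul W (0 : R) (0 : X →ₗ[R] Y) k

/-- The equivalence on `Ext^k(-, W)` induced by a linear equivalence. -/
def extCongr (e : X ≃ₗ[R] Y) (k : ℕ) : ExtMod R X W k ≃ₗ[R] ExtMod R Y W k :=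
  LinearEquiv.ofLinearMap (extMap W e.symm.toLinearMap k) (extMap W e.toLinearMap k)
    (by rw [← extMap_comp, e.comp_symm, extMap_id])
    (by rw [← extMap_comp, e.symm_comp, extMap_id])

/-- The identification of `Ext^0(X, W)` with the module of linear maps. -/
def extZero (X W : Type u) [AddCommGroup X] [Module R X] [AddCommGroup W] [Module R W] :
    ExtMod R X W 0 ≃ₗ[R] (X →ₗ[R] W) :=
  Ext.linearEquiv₀ (R := R) ≪≫ₗ ModuleCat.homLinearEquiv

lemma extMap_extZero_symm (f : X →ₗ[R] Y) (g : Y →ₗ[R] W) :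
    extMap W f 0 ((extZero Y W).symm g) = (extZero X W).symm (g ∘ₗ f) :=
  Ext.mk₀_comp_mk₀ (ModuleCat.ofHom f) (ModuleCat.ofHom g)

lemma shortExact_of_exact {f : X →ₗ[R] Y} {g : Y →ₗ[R] Z} (hf : Injective f)
    (hfg : Exact f g) (hg : Surjective g) :
    (ModuleCat.shortComplexOfCompEqZero f g hfg.linearMap_comp_eq_zero).ShortExact where
  exact := ModuleCat.shortComplex_exact _ hfg
  mono_f := (ModuleCat.mono_iff_injective _).mpr hf
  epi_g := (ModuleCat.epi_iff_surjective _).mpr hg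

variable {f : X →ₗ[R] Y} {g : Y →ₗ[R] Z} (hf : Injective f) (hfg : Exact f g) (hg : Surjective g)

/-- The connecting map `Ext^k(X, W) → Ext^(k+1)(Z, W)` of a short exact sequence
`0 → X → Y → Z → 0`. -/
def extConn (k : ℕ) : ExtMod R X W k →ₗ[R] ExtMod R Z W (k + 1) :=
  (shortExact_of_exact hf hfg hg).extClass.precompOfLinear R (ModuleCat.of R W) (add_comm 1 k)

/-- The connecting map `Hom(X, W) → Ext^1(Z, W)` of a short exact sequence
`0 → X → Y → Z → 0`. -/
def homConn : (X →ₗ[R] W) →ₗ[R] ExtMod R Z W 1 :=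
  extConn W hf hfg hg 0 ∘ₗ (extZero X W).symm.toLinearMap

include hf hfg hg in
lemma exact_extMap_extMap (k : ℕ) : Exact (extMap W g k) (extMap W f k) := by
  refine LinearMap.exact_of_comp_of_mem_range ?_ fun x hx ↦
    Ext.contravariant_sequence_exact₂ (shortExact_of_exact hf hfg hg) _ x hx
  rw [← extMap_comp, hfg.linearMap_comp_eq_zero, extMap_zero]

lemma exact_extMap_extConn (k : ℕ) : Exact (extMap W f k) (extConn W hf hfg hg k) :=
  LinearMap.exact_of_comp_of_mem_range
    (LinearMap.ext ((shortExact_of_exact hf hfg hg).extClass_comp_assoc (h := add_comm 1 k)))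
    fun x hx ↦ Ext.contravariant_sequence_exact₁ (shortExact_of_exact hf hfg hg) _ x
      (add_comm 1 k) hx

lemma exact_extConn_extMap (k : ℕ) : Exact (extConn W hf hfg hg k) (extMap W g (k + 1)) :=
  LinearMap.exact_of_comp_of_mem_range
    (LinearMap.ext fun x ↦ (shortExact_of_exact hf hfg hg).comp_extClass_assoc x (add_comm 1 k))
    fun x hx ↦ Ext.contravariant_sequence_exact₃ (shortExact_of_exact hf hfg hg) _ x hx
      (add_comm 1 k)

lemma exact_lcomp_homConn : Exact (f.lcomp R W) (homConn W hf hfg hg) :=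
  (Exact.iff_of_ladder_linearEquiv (e₁ := (extZero Y W).symm) (e₂ := (extZero X W).symm)
    (e₃ := .refl R (ExtMod R Z W 1)) (LinearMap.ext (extMap_extZero_symm W f)) rfl).mp
    (exact_extMap_extConn W hf hfg hg 0)

lemma exact_homConn_extMap : Exact (homConn W hf hfg hg) (extMap W g 1) :=
  (LinearEquiv.precomp_exact_iff_exact (e := (extZero X W).symm)).mpr
    (exact_extConn_extMap W hf hfg hg 0)

lemma homConn_surjective [Subsingleton (ExtMod R Y W 1)] : Surjective (homConn W hf hfg hg) :=
  fun _ ↦ (exact_homConn_extMap W hf hfg hg _).mp (Subsingleton.elim _ _)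

include hf hfg hg in
lemma lcomp_surjective [Subsingleton (ExtMod R Z W 1)] : Surjective (f.lcomp R W) :=
  fun _ ↦ (exact_lcomp_homConn W hf hfg hg _).mp (Subsingleton.elim _ _)

include hf hfg hg in
lemma subsingleton_ext_one_of_lcomp_surjective [Subsingleton (ExtMod R Y W 1)]
    (h : Surjective (f.lcomp R W)) : Subsingleton (ExtMod R Z W 1) := by
  have hzero := (LinearMap.surjective_iff_eq_zero_of_exact (exact_lcomp_homConn W hf hfg hg)).mp h
  refine subsingleton_of_forall_eq 0 fun x ↦ ?_
  obtain ⟨φ, rfl⟩ := homConn_surjective W hf hfg hg x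
  rw [hzero, LinearMap.zero_apply]

lemma extConn_injective (k : ℕ) [Subsingleton (ExtMod R Y W k)] :
    Injective (extConn W hf hfg hg k) :=
  (LinearMap.injective_iff_eq_zero_of_exact (exact_extMap_extConn W hf hfg hg k)).mpr
    (Subsingleton.elim _ _)

lemma extConn_bijective (k : ℕ) [Subsingleton (ExtMod R Y W k)]
    [Subsingleton (ExtMod R Y W (k + 1))] : Bijective (extConn W hf hfg hg k) :=
  ⟨extConn_injective W hf hfg hg k,
    (LinearMap.surjective_iff_eq_zero_of_exact (exact_extConn_extMap W hf hfg hg k)).mpr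
      (Subsingleton.elim _ _)⟩

include hf hfg hg in
lemma extMap_injective {n : ℕ} (hX : ∀ i < n, Subsingleton (ExtMod R X W i)) :
    Injective (extMap W g n) := by
  cases n with
  | zero =>
    refine (extZero Z W).symm.surjective.forall₂.mpr fun φ ψ h ↦ ?_
    rw [extMap_extZero_symm, extMap_extZero_symm] at h
    exact congr_arg _ (LinearMap.cancel_right hg |>.mp ((extZero Y W).symm.injective h))
  | succ n =>
    have := hX n (Nat.lt_succ_self n)
    exact (LinearMap.injective_iff_eq_zero_of_exact (exact_extConn_extMap W hf hfg hg n)).mpr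
      (Subsingleton.elim _ _)

end LongExactSequence

section Acyclic

variable (R : Type u) [CommRing R] (W : Type u) [AddCommGroup W] [Module R W]

/-- `X` is acyclic for the functor `Hom(-, W)`: `Ext^k(X, W) = 0` for all `k > 0`. -/
def IsHomAcyclic (X : Type u) [AddCommGroup X] [Module R X] : Prop :=
  ∀ k, Subsingleton (ExtMod R X W (k + 1))

variable {R W} {X Y Z : Type u} [AddCommGroup X] [Module R X]
  [AddCommGroup Y] [Module R Y] [AddCommGroup Z] [Module R Z]

variable (R W) in
lemma isHomAcyclic_of_projective (P : Type u) [AddCommGroup P] [Module R P]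
    [Module.Projective R P] : IsHomAcyclic R W P := fun k ↦
  have : Projective (ModuleCat.of R P) := (IsProjective.iff_projective P).mp ‹_›
  Abelian.Ext.subsingleton_of_projective _ _ k

lemma IsHomAcyclic.congr (hX : IsHomAcyclic R W X) (e : X ≃ₗ[R] Y) : IsHomAcyclic R W Y := fun k ↦
  have := hX k
  (extCongr W e (k + 1)).symm.toEquiv.subsingleton

variable {f : X →ₗ[R] Y} {g : Y →ₗ[R] Z} (hf : Injective f) (hfg : Exact f g) (hg : Surjective g)

include hf hfg hg

lemma subsingleton_ext_left (k : ℕ) [Subsingleton (ExtMod R Y W k)]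
    [Subsingleton (ExtMod R Z W (k + 1))] : Subsingleton (ExtMod R X W k) :=
  ((LinearMap.surjective_iff_eq_zero_of_exact (exact_extMap_extConn W hf hfg hg k)).mpr
    (Subsingleton.elim _ _)).subsingleton

lemma IsHomAcyclic.left (hY : IsHomAcyclic R W Y) (hZ : IsHomAcyclic R W Z) :
    IsHomAcyclic R W X := fun k ↦
  have := hY k
  have := hZ (k + 1)
  subsingleton_ext_left hf hfg hg (k + 1)

lemma subsingleton_ext_middle (k : ℕ) [Subsingleton (ExtMod R X W k)]
    [Subsingleton (ExtMod R Z W k)] : Subsingleton (ExtMod R Y W k) :=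
  ((LinearMap.injective_iff_eq_zero_of_exact (exact_extMap_extMap W hf hfg hg k)).mpr
    (Subsingleton.elim _ _)).subsingleton

lemma IsHomAcyclic.middle (hX : IsHomAcyclic R W X) (hZ : IsHomAcyclic R W Z) :
    IsHomAcyclic R W Y := fun k ↦
  have := hX k
  have := hZ k
  subsingleton_ext_middle hf hfg hg (k + 1)

lemma subsingleton_ext_right (k : ℕ) [Subsingleton (ExtMod R X W k)]
    [Subsingleton (ExtMod R Y W (k + 1))] : Subsingleton (ExtMod R Z W (k + 1)) :=
  ((LinearMap.surjective_iff_eq_zero_of_exact (exact_extConn_extMap W hf hfg hg k)).mpr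
    (Subsingleton.elim _ _)).subsingleton

lemma IsHomAcyclic.extMap_bijective (hZ : IsHomAcyclic R W Z) (k : ℕ) :
    Bijective (extMap W f (k + 1)) :=
  have := hZ k
  have := hZ (k + 1)
  ⟨(LinearMap.injective_iff_eq_zero_of_exact (exact_extMap_extMap W hf hfg hg (k + 1))).mpr
    (Subsingleton.elim _ _),
   (LinearMap.surjective_iff_eq_zero_of_exact (exact_extMap_extConn W hf hfg hg (k + 1))).mpr
    (Subsingleton.elim _ _)⟩

end Acyclic

section FiveTerm

variable {R : Type u} [CommRing R] {W : Type u} [AddCommGroup W] [Module R W]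
  {T D' B C D E : Type u} [AddCommGroup T] [Module R T] [AddCommGroup D'] [Module R D']
  [AddCommGroup B] [Module R B] [AddCommGroup C] [Module R C] [AddCommGroup D] [Module R D]
  [AddCommGroup E] [Module R E]
  {τ : T →ₗ[R] D'} {q : D' →ₗ[R] B} {i : B →ₗ[R] C} {p : C →ₗ[R] D}
  (hτ : Injective τ) (hτq : Exact τ q) (hq : Surjective q)
  (hi : Injective i) (hip : Exact i p) (hp : Surjective p)
  {π : (D' →ₗ[R] W) →ₗ[R] E} (hπ : Surjective π) (hπ' : Exact ((i ∘ₗ q).lcomp R W) π)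

include hq hi hip hp hπ' in
lemma exists_injective_ext_one_to_coker [Subsingleton (ExtMod R C W 1)] :
    ∃ g : ExtMod R D W 1 →ₗ[R] E, Injective g ∧ g ∘ₗ homConn W hi hip hp = π ∘ₗ q.lcomp R W := by
  have hδ := homConn_surjective W hi hip hp
  obtain ⟨g, hg⟩ := (LinearMap.exact_lcomp_of_exact_of_surjective E
    (exact_lcomp_homConn W hi hip hp) hδ (π ∘ₗ q.lcomp R W)).mp hπ'.linearMap_comp_eq_zero
  refine ⟨g, (injective_iff_map_eq_zero g).mpr fun x hx ↦ ?_, hg⟩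
  obtain ⟨φ, rfl⟩ := hδ x
  obtain ⟨ψ, hψ⟩ := (hπ' (φ ∘ₗ q)).mp ((LinearMap.congr_fun hg φ).symm.trans hx)
  exact (exact_lcomp_homConn W hi hip hp φ).mpr
    ⟨ψ, LinearMap.lcomp_injective_of_surjective (S := R) q hq hψ⟩

include hτq hπ hπ' in
lemma exists_coker_to_hom : ∃ g : E →ₗ[R] (T →ₗ[R] W), g ∘ₗ π = τ.lcomp R W := by
  have hcomp : τ.lcomp R W ∘ₗ (i ∘ₗ q).lcomp R W = 0 := LinearMap.ext fun φ ↦ by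
    simp only [LinearMap.comp_apply, LinearMap.lcomp_apply', LinearMap.comp_assoc,
      hτq.linearMap_comp_eq_zero, LinearMap.comp_zero, LinearMap.zero_apply]
  exact (LinearMap.exact_lcomp_of_exact_of_surjective _ hπ' hπ _).mp hcomp

include hτ hτq hq hi hip hp hπ hπ' in
/-- The two short exact sequences splice along `B` to `0 → T → D' → C → D → 0`, and `E` is the
cokernel of `Hom(C, W) → Hom(D', W)`. -/
theorem exists_fiveTerm_exact [Subsingleton (ExtMod R C W 1)] [Subsingleton (ExtMod R C W 2)] :
    ∃ (g₁ : ExtMod R D W 1 →ₗ[R] E) (g₂ : E →ₗ[R] (T →ₗ[R] W))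
      (g₃ : (T →ₗ[R] W) →ₗ[R] ExtMod R D W 2) (g₄ : ExtMod R D W 2 →ₗ[R] ExtMod R D' W 1),
      Injective g₁ ∧ Exact g₁ g₂ ∧ Exact g₂ g₃ ∧ Exact g₃ g₄ := by
  obtain ⟨g₁, hg₁, hg₁'⟩ := exists_injective_ext_one_to_coker hq hi hip hp hπ'
  obtain ⟨g₂, hg₂⟩ := exists_coker_to_hom hτq hπ hπ'
  let ε : ExtMod R B W 1 ≃ₗ[R] ExtMod R D W 2 :=
    LinearEquiv.ofBijective _ (extConn_bijective W hi hip hp 1)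
  refine ⟨g₁, g₂, ε.toLinearMap ∘ₗ homConn W hτ hτq hq, extMap W q 1 ∘ₗ ε.symm.toLinearMap,
    hg₁, ?_, ?_, ?_⟩
  · have hqτ := LinearMap.exact_lcomp_of_exact_of_surjective W hτq hq
    rw [← Surjective.comp_exact_iff_exact (homConn_surjective W hi hip hp), hg₁']
    refine LinearMap.exact_of_comp_of_mem_range ?_ fun e he ↦ ?_
    · rw [← LinearMap.comp_assoc, hg₂, hqτ.linearMap_comp_eq_zero]
    · obtain ⟨φ, rfl⟩ := hπ e
      obtain ⟨ψ, rfl⟩ := (hqτ φ).mp ((LinearMap.congr_fun hg₂ φ).symm.trans he)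
      exact ⟨ψ, rfl⟩
  · rw [LinearEquiv.postcomp_exact_iff_exact, ← Surjective.comp_exact_iff_exact hπ, hg₂]
    exact exact_lcomp_homConn W hτ hτq hq
  · exact (LinearEquiv.conj_exact_iff_exact _ _ ε).mpr (exact_homConn_extMap W hτ hτq hq)

end FiveTerm

section Tensor

variable {R : Type u} [CommRing R] {W : Type u} [AddCommGroup W] [Module R W]
  (P : Type u) [AddCommGroup P] [Module R P] [Module.Projective R P]

lemma lcomp_lTensor_surjective {K G : Type*} [AddCommGroup K] [Module R K] [AddCommGroup G]
    [Module R G] {i : K →ₗ[R] G} (hi : Surjective (i.lcomp R W)) :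
    Surjective ((i.lTensor P).lcomp R W) := fun φ ↦ by
  obtain ⟨θ, hθ⟩ := Module.projective_lifting_property _ (curry φ) hi
  exact ⟨lift θ, TensorProduct.ext' fun p a ↦
    LinearMap.congr_fun (LinearMap.congr_fun hθ p) a⟩

variable {G A : Type u} [AddCommGroup G] [Module R G] [Module.Projective R G]
  [AddCommGroup A] [Module R A]

lemma subsingleton_ext_one_tensor {g : G →ₗ[R] A} (hg : Surjective g)
    [Subsingleton (ExtMod R A W 1)] : Subsingleton (ExtMod R (P ⊗[R] A) W 1) :=
  have hi := (LinearMap.ker g).injective_subtype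
  have : Subsingleton (ExtMod R (P ⊗[R] G) W 1) := isHomAcyclic_of_projective R W (P ⊗[R] G) 0
  subsingleton_ext_one_of_lcomp_surjective W
    (Module.Flat.lTensor_preserves_injective_linearMap (M := P) _ hi)
    (lTensor_exact P g.exact_subtype_ker_map hg) (LinearMap.lTensor_surjective P hg)
    (lcomp_lTensor_surjective P (lcomp_surjective W hi g.exact_subtype_ker_map hg))

lemma subsingleton_ext_succ_tensor {g : G →ₗ[R] A} (hg : Surjective g) (k : ℕ)
    [Subsingleton (ExtMod R (P ⊗[R] LinearMap.ker g) W k)] :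
    Subsingleton (ExtMod R (P ⊗[R] A) W (k + 1)) :=
  have := isHomAcyclic_of_projective R W (P ⊗[R] G) k
  subsingleton_ext_right (Module.Flat.lTensor_preserves_injective_linearMap (M := P) _
    (LinearMap.ker g).injective_subtype) (lTensor_exact P g.exact_subtype_ker_map hg)
    (LinearMap.lTensor_surjective P hg) k

lemma IsHomAcyclic.tensor {A : Type u} [AddCommGroup A] [Module R A] (hA : IsHomAcyclic R W A) :
    IsHomAcyclic R W (P ⊗[R] A) := fun k ↦ by
  have hg : Surjective (Finsupp.linearCombination R (id : A → A)) :=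
    Finsupp.linearCombination_id_surjective R A
  induction k generalizing A with
  | zero =>
    have : Subsingleton (ExtMod R A W 1) := hA 0
    exact subsingleton_ext_one_tensor P hg
  | succ k ih =>
    have hK := (isHomAcyclic_of_projective R W (A →₀ R)).left
      (LinearMap.ker _).injective_subtype (LinearMap.exact_subtype_ker_map _) hg hA
    have := ih hK (Finsupp.linearCombination_id_surjective R _)
    exact subsingleton_ext_succ_tensor P hg (k + 1)

end Tensor

section Complex

variable {R : Type u} [CommRing R] (K : ChainComplex (ModuleCat.{u} R) ℕ)

lemma pOpcycles_surjective (j : ℕ) : Surjective (K.pOpcycles j).hom :=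
  (ModuleCat.epi_iff_surjective _).mp inferInstance

lemma homologyι_injective (j : ℕ) : Injective (K.homologyι j).hom :=
  (ModuleCat.mono_iff_injective _).mp inferInstance

lemma exact_homologyι_fromOpcycles (j : ℕ) :
    Exact (K.homologyι (j + 1)).hom (K.fromOpcycles (j + 1) j).hom :=
  (ShortComplex.ShortExact.moduleCat_exact_iff_function_exact
    (.mk _ _ (K.homologyι_comp_fromOpcycles (j + 1) j))).mp
    (ShortComplex.exact_of_f_is_kernel _ (K.homologyIsKernel (j + 1) j (by simp)))

lemma exact_fromOpcycles_pOpcycles (j : ℕ) :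
    Exact (K.fromOpcycles (j + 1) j).hom (K.pOpcycles j).hom := by
  rw [← Surjective.comp_exact_iff_exact (pOpcycles_surjective K (j + 1)), ← ModuleCat.hom_comp,
    K.p_fromOpcycles]
  exact (ShortComplex.ShortExact.moduleCat_exact_iff_function_exact
    (.mk _ _ (K.d_pOpcycles (j + 1) j))).mp
    (ShortComplex.exact_of_g_is_cokernel _ (K.opcyclesIsCokernel (j + 1) j (by simp)))

/-- The boundaries in degree `j`: the image of the differential `K_(j+1) → K_j`, which factors
through the opcycles `K_(j+1) / im(K_(j+2))`. -/
abbrev boundaries (j : ℕ) : Submodule R (K.X j) := LinearMap.range (K.fromOpcycles (j + 1) j).hom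

lemma exact_boundaries_pOpcycles (j : ℕ) : Exact (boundaries K j).subtype (K.pOpcycles j).hom :=
  LinearMap.exact_iff.mpr
    ((exact_fromOpcycles_pOpcycles K j).linearMap_ker_eq.trans (boundaries K j).range_subtype.symm)

variable {K} {W : Type u} [AddCommGroup W] [Module R W] (hK : ∀ j, IsHomAcyclic R W (K.X j))
  {T : ℕ → Type u} [∀ j, AddCommGroup (T j)] [∀ j, Module R (T j)]
  (e : ∀ j, T j ≃ₗ[R] K.homology j)

lemma exact_rangeRestrict_fromOpcycles (j : ℕ) :
    Exact ((K.homologyι (j + 1)).hom ∘ₗ (e (j + 1)).toLinearMap)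
      (K.fromOpcycles (j + 1) j).hom.rangeRestrict := by
  rw [LinearEquiv.precomp_exact_iff_exact, ← Injective.comp_exact_iff_exact
    (boundaries K j).injective_subtype]
  exact exact_homologyι_fromOpcycles K j

lemma homologyι_comp_injective (j : ℕ) :
    Injective ((K.homologyι j).hom ∘ₗ (e j).toLinearMap) :=
  (homologyι_injective K j).comp (e j).injective

include hK in
lemma isHomAcyclic_boundaries {j : ℕ} (hD : IsHomAcyclic R W (K.opcycles j)) :
    IsHomAcyclic R W (boundaries K j) :=
  (hK j).left (boundaries K j).injective_subtype (exact_boundaries_pOpcycles K j)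
    (pOpcycles_surjective K j) hD

include hK e in
lemma isHomAcyclic_opcycles {j : ℕ} (hT : ∀ i ≤ j, IsHomAcyclic R W (T i)) :
    IsHomAcyclic R W (K.opcycles j) := by
  induction j with
  | zero => exact (hT 0 le_rfl).congr (e 0 ≪≫ₗ K.isoHomologyι₀.toLinearEquiv)
  | succ j ih =>
    exact (hT (j + 1) le_rfl).middle (homologyι_comp_injective e (j + 1))
      (exact_rangeRestrict_fromOpcycles e j) (LinearMap.surjective_rangeRestrict _)
      (isHomAcyclic_boundaries hK (ih fun i hi ↦ hT i (hi.trans j.le_succ)))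

include hK e in
lemma nonempty_ext_opcycles_equiv {n : ℕ} (hT : ∀ j < n, IsHomAcyclic R W (T j)) (k : ℕ) :
    Nonempty (ExtMod R (K.opcycles n) W (k + 1) ≃ₗ[R] ExtMod R (T n) W (k + 1)) := by
  obtain _ | n := n
  · exact ⟨extCongr W (e 0 ≪≫ₗ K.isoHomologyι₀.toLinearEquiv).symm (k + 1)⟩
  · have hD := isHomAcyclic_opcycles hK e fun i hi ↦ hT i (Nat.lt_succ_of_le hi)
    exact ⟨.ofBijective _ ((isHomAcyclic_boundaries hK hD).extMap_bijective
      (homologyι_comp_injective e (n + 1)) (exact_rangeRestrict_fromOpcycles e n)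
      (LinearMap.surjective_rangeRestrict _) k)⟩

variable {E : ℕ → Type u} [∀ j, AddCommGroup (E j)] [∀ j, Module R (E j)]
  {π : ∀ j, (K.opcycles j →ₗ[R] W) →ₗ[R] E j} (hπ : ∀ j, Surjective (π j))
  (hπ' : ∀ j, Exact ((K.fromOpcycles (j + 1) j).hom.lcomp R W) (π (j + 1)))

include hK e hπ hπ' in
/-- One step of the spectral sequence `Ext^p(T_q, W) ⇒ E_(p+q)` of a complex `K` of
`Hom(-, W)`-acyclic modules with homology `T` and with `E` the cohomology of `Hom(K, W)`. -/
lemma exists_exact_opcycles (j : ℕ) :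
    ∃ (g₁ : ExtMod R (K.opcycles j) W 1 →ₗ[R] E (j + 1)) (g₂ : E (j + 1) →ₗ[R] (T (j + 1) →ₗ[R] W))
      (g₃ : (T (j + 1) →ₗ[R] W) →ₗ[R] ExtMod R (K.opcycles j) W 2)
      (g₄ : ExtMod R (K.opcycles j) W 2 →ₗ[R] ExtMod R (K.opcycles (j + 1)) W 1),
      Injective g₁ ∧ Exact g₁ g₂ ∧ Exact g₂ g₃ ∧ Exact g₃ g₄ :=
  have := hK j 0
  have := hK j 1
  exists_fiveTerm_exact (homologyι_comp_injective e (j + 1)) (exact_rangeRestrict_fromOpcycles e j)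
    (LinearMap.surjective_rangeRestrict _) (boundaries K j).injective_subtype
    (exact_boundaries_pOpcycles K j) (pOpcycles_surjective K j) (hπ (j + 1)) (hπ' j)

include hK e hπ hπ' in
lemma nonempty_equiv_dual_homology {n : ℕ} (hT : ∀ j < n, IsHomAcyclic R W (T j))
    (hπ₀ : Injective (π 0)) {j : ℕ} (hj : j ≤ n) : Nonempty (E j ≃ₗ[R] (T j →ₗ[R] W)) := by
  obtain _ | j := j
  · exact ⟨(LinearEquiv.ofBijective (π 0) ⟨hπ₀, hπ 0⟩).symm ≪≫ₗ
      LinearEquiv.congrLeft W R (e 0 ≪≫ₗ K.isoHomologyι₀.toLinearEquiv).symm⟩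
  · obtain ⟨g₁, g₂, g₃, -, -, h₁₂, h₂₃, -⟩ := exists_exact_opcycles hK e hπ hπ' j
    have hD := isHomAcyclic_opcycles hK e (j := j) fun i hi ↦ hT i (by lia)
    have := hD 0
    have := hD 1
    exact ⟨.ofBijective g₂ ⟨(LinearMap.injective_iff_eq_zero_of_exact h₁₂).mpr
      (Subsingleton.elim _ _), (LinearMap.surjective_iff_eq_zero_of_exact h₂₃).mpr
      (Subsingleton.elim _ _)⟩⟩

include hK e hπ hπ' in
lemma exists_fiveTerm_exact_homology {n : ℕ} (hT : ∀ j < n, IsHomAcyclic R W (T j)) :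
    ∃ (f₁ : ExtMod R (T n) W 1 →ₗ[R] E (n + 1)) (f₂ : E (n + 1) →ₗ[R] (T (n + 1) →ₗ[R] W))
      (f₃ : (T (n + 1) →ₗ[R] W) →ₗ[R] ExtMod R (T n) W 2)
      (f₄ : ExtMod R (T n) W 2 →ₗ[R] E (n + 2)),
      Injective f₁ ∧ Exact f₁ f₂ ∧ Exact f₂ f₃ ∧ Exact f₃ f₄ := by
  obtain ⟨g₁, g₂, g₃, g₄, hg₁, h₁₂, h₂₃, h₃₄⟩ := exists_exact_opcycles hK e hπ hπ' n
  obtain ⟨i, -, -, -, hi, -⟩ := exists_exact_opcycles hK e hπ hπ' (n + 1)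
  obtain ⟨e₁⟩ := nonempty_ext_opcycles_equiv hK e hT 0
  obtain ⟨e₂⟩ := nonempty_ext_opcycles_equiv hK e hT 1
  refine ⟨g₁ ∘ₗ e₁.symm.toLinearMap, g₂, e₂.toLinearMap ∘ₗ g₃, (i ∘ₗ g₄) ∘ₗ e₂.symm.toLinearMap,
    hg₁.comp e₁.symm.injective, ?_, ?_, ?_⟩
  · exact LinearEquiv.precomp_exact_iff_exact.mpr h₁₂
  · exact LinearEquiv.postcomp_exact_iff_exact.mpr h₂₃
  · exact (LinearEquiv.conj_exact_iff_exact _ _ e₂).mpr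
      ((Injective.comp_exact_iff_exact hi).mpr h₃₄)

end Complex

section Tor

variable {R : Type u} [CommRing R] {M : Type u} [AddCommGroup M] [Module R M]

section Resolution

variable (P : ProjectiveResolution (ModuleCat.of R M))

lemma extMk_eq_zero_of_degree_zero {Y : ModuleCat.{u} R} {f : P.complex.X 0 ⟶ Y}
    (hf : P.complex.d 1 0 ≫ f = 0) (h : (P.extMk f 1 rfl hf : Ext.{u} _ Y 0) = 0) : f = 0 := by
  rw [← P.extEquivCohomologyClass.apply_eq_iff_eq, P.extEquivCohomologyClass_extMk,
    P.extEquivCohomologyClass_zero, CochainComplex.HomComplex.CohomologyClass.mk_eq_zero_iff,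
    CochainComplex.HomComplex.Cocycle.toSingleMk_mem_coboundaries_iff _ _ _ _ _ 1 (by lia)] at h
  obtain ⟨g, hg⟩ := h
  have : g = 0 := (P.cochainComplex.isZero_of_isStrictlyLE 0 1 (by lia)).eq_of_src _ _
  rw [← cancel_epi (P.cochainComplexXIso (-(0 : ℕ)) 0 rfl).hom, ← hg, this]
  simp only [Limits.comp_zero]

lemma smul_extMk {Y : ModuleCat.{u} R} {j : ℕ} (r : R) (f : P.complex.X j ⟶ Y)
    (hf : P.complex.d (j + 1) j ≫ f = 0) (hf' : P.complex.d (j + 1) j ≫ (r • f) = 0) :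
    P.extMk (r • f) (j + 1) rfl hf' = (r • P.extMk f (j + 1) rfl hf : Ext.{u} _ Y j) := by
  rw [Ext.smul_eq_comp_mk₀, P.extMk_comp_mk₀]
  congr 1

variable (A : Type u) [AddCommGroup A] [Module R A]

/-- The complex `P ⊗ A`, whose homology is `Tor(M, A)`. -/
def tensorComplex : ChainComplex (ModuleCat.{u} R) ℕ :=
  (((MonoidalCategory.tensoringRight (ModuleCat.{u} R)).obj
    (ModuleCat.of R A)).mapHomologicalComplex _).obj P.complex

/-- The identification of `Tor(M, A)` with the homology of `P ⊗ A`. -/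
def torEquiv (j : ℕ) : TorMod R M A j ≃ₗ[R] (tensorComplex P A).homology j :=
  (P.isoLeftDerivedObj ((MonoidalCategory.tensoringRight (ModuleCat.{u} R)).obj
    (ModuleCat.of R A)) j).toLinearEquiv

variable {A} {W : Type u} [AddCommGroup W] [Module R W]

lemma isHomAcyclic_tensorComplex (hA : IsHomAcyclic R W A) (j : ℕ) :
    IsHomAcyclic R W ((tensorComplex P A).X j) :=
  have : Module.Projective R (P.complex.X j) := by
    rw [IsProjective.iff_projective]; exact P.projective j
  hA.tensor (P.complex.X j)

variable {N : Type u} [AddCommGroup N] [Module R N] (e : N ≃ₗ[R] (A →ₗ[R] W))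

/-- Hom-tensor adjunction `Hom(P_j ⊗ A, W) ≃ Hom(P_j, N)`, where `N ≃ Hom(A, W)`. -/
def cochainEquiv (j : ℕ) :
    ((tensorComplex P A).X j →ₗ[R] W) ≃ₗ[R] (P.complex.X j →ₗ[R] N) :=
  (TensorProduct.lift.equiv (.id R) (P.complex.X j) A W).symm ≪≫ₗ LinearEquiv.congrRight e.symm

lemma cochainEquiv_comp_d (i j : ℕ) (φ : (tensorComplex P A).X j →ₗ[R] W) :
    cochainEquiv P e i (φ ∘ₗ ((tensorComplex P A).d i j).hom) =
      cochainEquiv P e j φ ∘ₗ (P.complex.d i j).hom := by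
  ext x
  exact congr_arg e.symm (LinearMap.ext fun a ↦ rfl)

/-- The cocycle with values in `N ≃ Hom(A, W)` given by a linear form on the cokernel
`K_j / im K_(j+1)`, where `K = P ⊗ A`. -/
def opcyclesToCochain (j : ℕ) :
    ((tensorComplex P A).opcycles j →ₗ[R] W) →ₗ[R] (P.complex.X j →ₗ[R] N) :=
  (cochainEquiv P e j).toLinearMap ∘ₗ ((tensorComplex P A).pOpcycles j).hom.lcomp R W

lemma d_comp_opcyclesToCochain (j : ℕ) (φ : (tensorComplex P A).opcycles j →ₗ[R] W) :
    P.complex.d (j + 1) j ≫ ModuleCat.ofHom (opcyclesToCochain P e j φ) = 0 :=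
  ModuleCat.hom_ext <| (cochainEquiv_comp_d P e _ j _).symm.trans <| by
    rw [LinearMap.lcomp_apply', LinearMap.comp_assoc, ← ModuleCat.hom_comp,
      (tensorComplex P A).d_pOpcycles, ModuleCat.hom_zero, LinearMap.comp_zero, map_zero]
    rfl

lemma exists_opcyclesToCochain_eq {j : ℕ} {f : P.complex.X j →ₗ[R] N}
    (hf : f ∘ₗ (P.complex.d (j + 1) j).hom = 0) : ∃ φ, opcyclesToCochain P e j φ = f := by
  obtain ⟨φ, rfl⟩ := (cochainEquiv P e j).surjective f
  rw [← cochainEquiv_comp_d, LinearEquiv.map_eq_zero_iff] at hf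
  have hφ : (tensorComplex P A).d (j + 1) j ≫ ModuleCat.ofHom φ = 0 := ModuleCat.hom_ext hf
  exact ⟨((tensorComplex P A).descOpcycles (ModuleCat.ofHom φ) (j + 1) (by simp) hφ).hom,
    congr_arg (cochainEquiv P e j) (congr_arg ModuleCat.Hom.hom
      ((tensorComplex P A).p_descOpcycles (ModuleCat.ofHom φ) (j + 1) (by simp) hφ))⟩

lemma opcyclesToCochain_injective (j : ℕ) : Function.Injective (opcyclesToCochain P e j) :=
  (cochainEquiv P e j).injective.comp
    (LinearMap.lcomp_injective_of_surjective (S := R) _ (pOpcycles_surjective _ j))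

lemma opcyclesToCochain_comp_fromOpcycles (j : ℕ) (ψ : (tensorComplex P A).X j →ₗ[R] W) :
    opcyclesToCochain P e (j + 1) (ψ ∘ₗ ((tensorComplex P A).fromOpcycles (j + 1) j).hom) =
      cochainEquiv P e j ψ ∘ₗ (P.complex.d (j + 1) j).hom := by
  rw [← cochainEquiv_comp_d, ← (tensorComplex P A).p_fromOpcycles]
  rfl

/-- The linear map sending a linear form on the cokernel `K_j / im K_(j+1)`, where `K = P ⊗ A`, to
the class in `Ext^j(M, N)` of the corresponding cocycle. -/
def extOfOpcycles (j : ℕ) : ((tensorComplex P A).opcycles j →ₗ[R] W) →ₗ[R] ExtMod R M N j where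
  toFun φ := P.extMk (Y := ModuleCat.of R N) (ModuleCat.ofHom (opcyclesToCochain P e j φ)) (j + 1)
    rfl (d_comp_opcyclesToCochain P e j φ)
  map_add' φ ψ := by
    rw [P.add_extMk]
    congr 1
    exact congr_arg ModuleCat.ofHom (map_add _ φ ψ)
  map_smul' r φ := by
    have hr : ModuleCat.ofHom (opcyclesToCochain P e j (r • φ)) =
        r • ModuleCat.ofHom (opcyclesToCochain P e j φ) :=
      congr_arg ModuleCat.ofHom (map_smul _ r φ)
    exact (by congr 1 : _ = _).trans
      (smul_extMk P r _ (d_comp_opcyclesToCochain P e j φ) (hr ▸ d_comp_opcyclesToCochain P e j _))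

lemma extOfOpcycles_surjective (j : ℕ) : Surjective (extOfOpcycles P e j) := fun x ↦ by
  obtain ⟨f, hf, rfl⟩ := P.extMk_surjective x (j + 1) rfl
  obtain ⟨φ, hφ⟩ := exists_opcyclesToCochain_eq P e (congr_arg ModuleCat.Hom.hom hf)
  obtain rfl : ModuleCat.ofHom (opcyclesToCochain P e j φ) = f := ModuleCat.hom_ext hφ
  exact ⟨φ, rfl⟩

lemma exact_fromOpcycles_extOfOpcycles (j : ℕ) :
    Exact (((tensorComplex P A).fromOpcycles (j + 1) j).hom.lcomp R W)
      (extOfOpcycles P e (j + 1)) := fun φ ↦ by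
  refine (P.extMk_eq_zero_iff (Y := ModuleCat.of R N) _ _ rfl
    (d_comp_opcyclesToCochain P e (j + 1) φ) j rfl).trans ?_
  constructor
  · rintro ⟨g, hg⟩
    obtain ⟨ψ, hψ⟩ := (cochainEquiv P e j).surjective g.hom
    refine ⟨ψ, opcyclesToCochain_injective P e (j + 1) ?_⟩
    exact (opcyclesToCochain_comp_fromOpcycles P e j ψ).trans
      ((congr_arg (· ∘ₗ _) hψ).trans (congr_arg ModuleCat.Hom.hom hg))
  · rintro ⟨ψ, rfl⟩
    exact ⟨ModuleCat.ofHom (cochainEquiv P e j ψ),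
      ModuleCat.hom_ext (opcyclesToCochain_comp_fromOpcycles P e j ψ).symm⟩

lemma extOfOpcycles_zero_injective : Function.Injective (extOfOpcycles P e 0) :=
  (injective_iff_map_eq_zero _).mpr fun φ hφ ↦
    (map_eq_zero_iff _ (opcyclesToCochain_injective P e 0)).mp
      (congr_arg ModuleCat.Hom.hom
        (extMk_eq_zero_of_degree_zero P (d_comp_opcyclesToCochain P e 0 φ) hφ))

end Resolution

variable {A W N : Type u} [AddCommGroup A] [Module R A] [AddCommGroup W] [Module R W]
  [AddCommGroup N] [Module R N] (e : N ≃ₗ[R] (A →ₗ[R] W)) (hA : IsHomAcyclic R W A) {n : ℕ}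
  (hT : ∀ j < n, IsHomAcyclic R W (TorMod R M A j))

include e hA hT in
theorem nonempty_ext_equiv_dual_tor {j : ℕ} (hj : j ≤ n) :
    Nonempty (ExtMod R M N j ≃ₗ[R] (TorMod R M A j →ₗ[R] W)) :=
  let P := projectiveResolution (ModuleCat.of R M)
  nonempty_equiv_dual_homology (isHomAcyclic_tensorComplex P hA) (torEquiv P A)
    (extOfOpcycles_surjective P e) (exact_fromOpcycles_extOfOpcycles P e) hT
    (extOfOpcycles_zero_injective P e) hj

include e hA hT in
theorem exists_fiveTerm_exact_ext_tor :
    ∃ (f₁ : ExtMod R (TorMod R M A n) W 1 →ₗ[R] ExtMod R M N (n + 1))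
      (f₂ : ExtMod R M N (n + 1) →ₗ[R] (TorMod R M A (n + 1) →ₗ[R] W))
      (f₃ : (TorMod R M A (n + 1) →ₗ[R] W) →ₗ[R] ExtMod R (TorMod R M A n) W 2)
      (f₄ : ExtMod R (TorMod R M A n) W 2 →ₗ[R] ExtMod R M N (n + 2)),
      Injective f₁ ∧ Exact f₁ f₂ ∧ Exact f₂ f₃ ∧ Exact f₃ f₄ :=
  let P := projectiveResolution (ModuleCat.of R M)
  exists_fiveTerm_exact_homology (isHomAcyclic_tensorComplex P hA) (torEquiv P A)
    (extOfOpcycles_surjective P e) (exact_fromOpcycles_extOfOpcycles P e) hT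

end Tor

section CovariantSequence

variable {R : Type u} [CommRing R] (X : Type u) [AddCommGroup X] [Module R X]
  {U V W : Type u} [AddCommGroup U] [Module R U] [AddCommGroup V] [Module R V]
  [AddCommGroup W] [Module R W]

/-- The map `Ext^k(X, U) → Ext^k(X, V)` induced by a linear map `U → V`. -/
def extMapRight (f : U →ₗ[R] V) (k : ℕ) : ExtMod R X U k →ₗ[R] ExtMod R X V k :=
  (Ext.mk₀ (ModuleCat.ofHom f)).postcompOfLinear R (ModuleCat.of R X) (add_zero k)

lemma extMapRight_extZero_symm (f : U →ₗ[R] V) (φ : X →ₗ[R] U) :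
    extMapRight X f 0 ((extZero X U).symm φ) = (extZero X V).symm (f ∘ₗ φ) :=
  Ext.mk₀_comp_mk₀ (ModuleCat.ofHom φ) (ModuleCat.ofHom f)

lemma extMapRight_lsmul (r : R) (k : ℕ) :
    extMapRight X (LinearMap.lsmul R U r) k = r • LinearMap.id := by
  ext x
  exact (Ext.smul_eq_comp_mk₀ x r).symm

variable {f : U →ₗ[R] V} {g : V →ₗ[R] W} (hf : Injective f) (hfg : Exact f g) (hg : Surjective g)

/-- The connecting map `Ext^k(X, W) → Ext^(k+1)(X, U)` of a short exact sequence
`0 → U → V → W → 0`. -/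
def extConnRight (k : ℕ) : ExtMod R X W k →ₗ[R] ExtMod R X U (k + 1) :=
  (shortExact_of_exact hf hfg hg).extClass.postcompOfLinear R (ModuleCat.of R X) rfl

include hf hfg hg in
lemma exact_extMapRight_extMapRight (k : ℕ) :
    Exact (extMapRight X f k) (extMapRight X g k) := by
  refine LinearMap.exact_of_comp_of_mem_range (LinearMap.ext fun x ↦ ?_) fun x hx ↦
    Ext.covariant_sequence_exact₂ _ (shortExact_of_exact hf hfg hg) x hx
  exact (Ext.comp_assoc_of_second_deg_zero x _ _ (add_zero k)).trans (by
    rw [Ext.mk₀_comp_mk₀, ← ModuleCat.ofHom_comp, hfg.linearMap_comp_eq_zero]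
    exact (congr_arg (x.comp · (add_zero k)) (Ext.mk₀_zero _ _)).trans (Ext.comp_zero ..))

lemma exact_extMapRight_extConnRight (k : ℕ) :
    Exact (extMapRight X g k) (extConnRight X hf hfg hg k) :=
  LinearMap.exact_of_comp_of_mem_range
    (LinearMap.ext fun x ↦ (Ext.comp_assoc_of_second_deg_zero x _ _ rfl).trans (by
      rw [(shortExact_of_exact hf hfg hg).comp_extClass, Ext.comp_zero]; rfl))
    fun x hx ↦ Ext.covariant_sequence_exact₃ _ (shortExact_of_exact hf hfg hg) x rfl hx

lemma exact_extConnRight_extMapRight (k : ℕ) :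
    Exact (extConnRight X hf hfg hg k) (extMapRight X f (k + 1)) :=
  LinearMap.exact_of_comp_of_mem_range
    (LinearMap.ext fun x ↦ (Ext.comp_assoc_of_third_deg_zero x _ _ rfl).trans (by
      rw [(shortExact_of_exact hf hfg hg).extClass_comp, Ext.comp_zero]; rfl))
    fun x hx ↦ Ext.covariant_sequence_exact₁ _ (shortExact_of_exact hf hfg hg) x hx rfl

end CovariantSequence

section RegularElement

variable {R : Type u} [CommRing R] {W : Type u} [AddCommGroup W] [Module R W] {r : R}
  (hr : IsSMulRegular W r)

/-- The connecting map `Ext^k(X, W / rW) → Ext^(k+1)(X, W)` for a `W`-regular element `r`. -/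
def extQuotConn (X : Type u) [AddCommGroup X] [Module R X] (k : ℕ) :
    ExtMod R X (QuotSMulTop r W) k →ₗ[R] ExtMod R X W (k + 1) :=
  extConnRight X (f := LinearMap.lsmul R W r) hr (LinearMap.exact_lsmul_mkQ_smul_top W r)
    (Submodule.mkQ_surjective _) k

variable {X : Type u} [AddCommGroup X] [Module R X]

lemma extQuotConn_injective (k : ℕ) [Subsingleton (ExtMod R X W k)] :
    Injective (extQuotConn hr X k) :=
  (LinearMap.injective_iff_eq_zero_of_exact (exact_extMapRight_extConnRight X _ _ _ k)).mpr
    (Subsingleton.elim _ _)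

lemma extQuotConn_surjective {k : ℕ} (h : ∀ x : ExtMod R X W (k + 1), r • x = 0) :
    Surjective (extQuotConn hr X k) := fun x ↦
  (exact_extConnRight_extMapRight X (f := LinearMap.lsmul R W r) hr
    (LinearMap.exact_lsmul_mkQ_smul_top W r) (Submodule.mkQ_surjective _) k x).mp
      (by rw [extMapRight_lsmul]; exact h x)

include hr in
lemma IsHomAcyclic.quotSMulTop (hX : IsHomAcyclic R W X) :
    IsHomAcyclic R (QuotSMulTop r W) X := fun k ↦
  have := hX k
  have := hX (k + 1)
  (extQuotConn_injective hr (k + 1)).subsingleton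

include hr in
lemma mkQ_compRight_surjective_of_isSMulRegular [Subsingleton (ExtMod R X W 1)] :
    Surjective ((r • (⊤ : Submodule R W)).mkQ.compRight R (M := X)) := fun φ ↦ by
  obtain ⟨y, hy⟩ := (exact_extMapRight_extConnRight X (f := LinearMap.lsmul R W r) hr
    (LinearMap.exact_lsmul_mkQ_smul_top W r) (Submodule.mkQ_surjective _) 0
    ((extZero X _).symm φ)).mp (Subsingleton.elim (α := ExtMod R X W 1) _ _)
  obtain ⟨ψ, rfl⟩ := (extZero X W).symm.surjective y
  rw [extMapRight_extZero_symm] at hy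
  exact ⟨ψ, (extZero X _).symm.injective hy⟩

include hr in
lemma ker_mkQ_compRight :
    LinearMap.ker ((r • (⊤ : Submodule R W)).mkQ.compRight R (M := X)) = r • ⊤ := by
  ext φ
  rw [Submodule.mem_smul_pointwise_iff_exists]
  refine ⟨fun hφ ↦ ?_, ?_⟩
  · obtain ⟨y, hy⟩ := (exact_extMapRight_extMapRight X (f := LinearMap.lsmul R W r) hr
      (LinearMap.exact_lsmul_mkQ_smul_top W r) (Submodule.mkQ_surjective _) 0
      ((extZero X W).symm φ)).mp ((extMapRight_extZero_symm X _ φ).trans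
        ((congr_arg (extZero X _).symm (LinearMap.mem_ker.mp hφ)).trans (map_zero _)))
    rw [extMapRight_lsmul] at hy
    exact ⟨extZero X W y, trivial, (map_smul (extZero X W) r y).symm.trans
      ((extZero X W).eq_symm_apply.mp hy)⟩
  · rintro ⟨ψ, -, rfl⟩
    ext x
    exact (Submodule.Quotient.mk_eq_zero _).mpr (Submodule.smul_mem_pointwise_smul _ r _ trivial)

/-- If `r` is `W`-regular and `Ext^1(X, W) = 0`, then `Hom(X, W) / r = Hom(X, W / rW)`. -/
def homQuotSMulTopEquiv [Subsingleton (ExtMod R X W 1)] :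
    QuotSMulTop r (X →ₗ[R] W) ≃ₗ[R] (X →ₗ[R] QuotSMulTop r W) :=
  Submodule.quotEquivOfEq _ _ (ker_mkQ_compRight hr).symm ≪≫ₗ
    LinearMap.quotKerEquivOfSurjective _ (mkQ_compRight_surjective_of_isSMulRegular hr)

end RegularElement

section RegularSequence

variable {R : Type u} [CommRing R] {W : Type u} [AddCommGroup W] [Module R W] {rs : List R}
  {X : Type u} [AddCommGroup X] [Module R X]

lemma smul_ext_eq_zero {r : R} (hX : ∀ x : X, r • x = 0) {k : ℕ} (x : ExtMod R X W k) :
    r • x = 0 := by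
  have hid : r • (LinearMap.id : X →ₗ[R] X) = 0 := LinearMap.ext hX
  rw [← LinearMap.id_apply (R := R) x, ← extMap_id, ← LinearMap.smul_apply, ← extMap_smul, hid,
    extMap_zero, LinearMap.zero_apply]

lemma subsingleton_ext_of_subsingleton [Subsingleton X] {k : ℕ} :
    Subsingleton (ExtMod R X W k) :=
  subsingleton_of_forall_eq 0 fun x ↦ (one_smul R x).symm.trans
    (smul_ext_eq_zero (fun _ ↦ Subsingleton.elim _ _) x)

lemma subsingleton_ext_of_lt_length (hW : IsWeaklyRegular W rs)
    (hX : ∀ r ∈ rs, ∀ x : X, r • x = 0) {i : ℕ} (hi : i < rs.length) :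
    Subsingleton (ExtMod R X W i) := by
  induction hW generalizing i with
  | nil => exact absurd hi (Nat.not_lt_zero i)
  | @cons W _ _ r rs hr _ ih =>
    rw [List.forall_mem_cons] at hX
    refine subsingleton_of_forall_eq 0 fun x ↦ ?_
    have hx : r • x = 0 := smul_ext_eq_zero hX.1 x
    cases i with
    | zero =>
      refine (extZero X W).injective (LinearMap.ext fun y ↦ hr ?_)
      simpa using congr_arg (extZero X W · y) hx
    | succ i =>
      have := ih hX.2 (Nat.lt_of_succ_lt_succ hi)
      exact ((extQuotConn_surjective hr (smul_ext_eq_zero hX.1)).subsingleton).elim _ _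

/-- Rees' theorem: the connecting map `Ext^k(X, W / rW) → Ext^(k+1)(X, W)` is bijective for
`k + 1 ≤ rs.length`, because `r` kills `X`. -/
lemma nonempty_ext_length_equiv (hW : IsWeaklyRegular W rs)
    (hX : ∀ r ∈ rs, ∀ x : X, r • x = 0) :
    Nonempty (ExtMod R X W rs.length ≃ₗ[R]
      (X →ₗ[R] W ⧸ (Ideal.ofList rs • ⊤ : Submodule R W))) := by
  induction hW with
  | nil W =>
    exact ⟨extZero X W ≪≫ₗ LinearEquiv.congrRight
      (Submodule.quotEquivOfEqBot _ (by rw [Ideal.ofList_nil, Submodule.bot_smul])).symm⟩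
  | @cons W _ _ r rs hr hrs ih =>
    have : Subsingleton (ExtMod R X W rs.length) :=
      subsingleton_ext_of_lt_length (hrs.cons hr) hX (Nat.lt_succ_self _)
    rw [List.forall_mem_cons] at hX
    obtain ⟨e⟩ := ih hX.2
    exact ⟨(LinearEquiv.ofBijective (extQuotConn hr X rs.length)
      ⟨extQuotConn_injective hr _, extQuotConn_surjective hr (smul_ext_eq_zero hX.1)⟩).symm
      ≪≫ₗ e ≪≫ₗ LinearEquiv.congrRight
        (Submodule.quotOfListConsSMulTopEquivQuotSMulTopInner W r rs).symm⟩

namespace IsHomAcyclic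

lemma isWeaklyRegular_hom (hX : IsHomAcyclic R W X) (hW : IsWeaklyRegular W rs) :
    IsWeaklyRegular (X →ₗ[R] W) rs := by
  induction hW with
  | nil W => exact .nil R _
  | @cons W _ _ r rs hr _ ih =>
    have : Subsingleton (ExtMod R X W 1) := hX 0
    exact .cons (fun φ ψ h ↦ LinearMap.ext fun x ↦ hr (LinearMap.congr_fun h x))
      (((homQuotSMulTopEquiv hr).isWeaklyRegular_congr rs).mpr (ih (hX.quotSMulTop hr)))

lemma mkQ_compRight_surjective (hX : IsHomAcyclic R W X) (hW : IsWeaklyRegular W rs) :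
    Surjective ((Ideal.ofList rs • (⊤ : Submodule R W)).mkQ.compRight R (M := X)) := by
  induction hW with
  | nil W =>
    let e := Submodule.quotEquivOfEqBot (Ideal.ofList ([] : List R) • (⊤ : Submodule R W))
      (by rw [Ideal.ofList_nil, Submodule.bot_smul])
    exact fun φ ↦ ⟨e.toLinearMap ∘ₗ φ, LinearMap.ext fun x ↦ e.symm_apply_apply (φ x)⟩
  | @cons W _ _ r rs hr _ ih =>
    let e := Submodule.quotOfListConsSMulTopEquivQuotSMulTopInner W r rs
    have : Subsingleton (ExtMod R X W 1) := hX 0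
    intro φ
    obtain ⟨ψ, hψ⟩ := ih (hX.quotSMulTop hr) (e.toLinearMap ∘ₗ φ)
    obtain ⟨χ, rfl⟩ := mkQ_compRight_surjective_of_isSMulRegular hr ψ
    exact ⟨χ, LinearMap.ext fun x ↦ e.injective (LinearMap.congr_fun hψ x)⟩

lemma nonempty_hom_quot_equiv (hX : IsHomAcyclic R W X) (hW : IsWeaklyRegular W rs) :
    Nonempty (((X →ₗ[R] W) ⧸ (Ideal.ofList rs • ⊤ : Submodule R (X →ₗ[R] W))) ≃ₗ[R]
      (X →ₗ[R] W ⧸ (Ideal.ofList rs • ⊤ : Submodule R W))) := by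
  induction hW with
  | nil W =>
    have hbot (Z : Type u) [AddCommGroup Z] [Module R Z] :
        (Ideal.ofList ([] : List R) • ⊤ : Submodule R Z) = ⊥ := by
      rw [Ideal.ofList_nil, Submodule.bot_smul]
    exact ⟨Submodule.quotEquivOfEqBot _ (hbot _) ≪≫ₗ
      LinearEquiv.congrRight (Submodule.quotEquivOfEqBot _ (hbot W)).symm⟩
  | @cons W _ _ r rs hr _ ih =>
    have : Subsingleton (ExtMod R X W 1) := hX 0
    let e := homQuotSMulTopEquiv (X := X) hr
    obtain ⟨e'⟩ := ih (hX.quotSMulTop hr)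
    exact ⟨Submodule.quotOfListConsSMulTopEquivQuotSMulTopInner _ r rs ≪≫ₗ
      Submodule.Quotient.equiv _ _ e (by
        rw [Submodule.map_smul'', Submodule.map_top, LinearEquiv.range]) ≪≫ₗ e' ≪≫ₗ
      LinearEquiv.congrRight (Submodule.quotOfListConsSMulTopEquivQuotSMulTopInner W r rs).symm⟩

end IsHomAcyclic

end RegularSequence

section Nakayama

variable {R : Type u} [CommRing R] [IsLocalRing R]

lemma subsingleton_of_smul_top_eq_top {I : Ideal R} (hI : I ≤ maximalIdeal R) {X : Type*}
    [AddCommGroup X] [Module R X] [Module.Finite R X] (h : I • (⊤ : Submodule R X) = ⊤) :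
    Subsingleton X := by
  by_contra hX
  rw [not_subsingleton_iff_nontrivial] at hX
  exact Submodule.top_ne_ideal_smul_of_le_jacobson_annihilator
    (hI.trans (maximalIdeal_le_jacobson _)) h.symm

lemma bijective_of_bijective_mapQ [IsNoetherianRing R] {X Y : Type*} [AddCommGroup X] [Module R X]
    [Module.Finite R X] [AddCommGroup Y] [Module R Y] [Module.Finite R Y] {rs : List R}
    (hm : Ideal.ofList rs ≤ maximalIdeal R) (hY : IsWeaklyRegular Y rs) {f : X →ₗ[R] Y}
    (hf : Bijective (Submodule.mapQ _ _ f
      (Submodule.smul_top_le_comap_smul_top (Ideal.ofList rs) f))) : Bijective f := by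
  have hsurj : Surjective f := f.surjective_of_surjective_comp_mkQ (Ideal.ofList rs)
    (hm.trans (maximalIdeal_le_jacobson ⊥)) (hf.2.comp (Submodule.mkQ_surjective _))
  refine ⟨LinearMap.ker_eq_bot.mp (Submodule.subsingleton_iff_eq_bot.mp ?_), hsurj⟩
  let i := (LinearMap.ker f).subtype
  have hi : Injective (Submodule.mapQ _ _ i
      (Submodule.smul_top_le_comap_smul_top (Ideal.ofList rs) i)) := by
    refine (LinearMap.injective_iff_eq_zero_of_exact
      (map_first_exact_on_four_term_right_exact_of_isSMulRegular_last
        (f₁ := (0 : Unit →ₗ[R] LinearMap.ker f))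
        (LinearMap.exact_zero_iff_injective _ i |>.mpr (Submodule.injective_subtype _))
        f.exact_subtype_ker_map hsurj hY)).mpr ?_
    ext
    rfl
  refine subsingleton_of_smul_top_eq_top hm (eq_top_iff.mpr fun x _ ↦ ?_)
  rw [← Submodule.Quotient.mk_eq_zero]
  refine hi (hf.1 ?_)
  rw [map_zero, map_zero, Submodule.mapQ_apply, Submodule.mapQ_apply,
    show f (i x) = 0 from x.2, Submodule.Quotient.mk_zero]

variable [IsNoetherianRing R] {W : Type u} [AddCommGroup W] [Module R W] [Module.Finite R W]
  {X : Type u} [AddCommGroup X] [Module R X] [Module.Finite R X]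

lemma subsingleton_ext_of_quotSMulTop {r : R} (hr : IsSMulRegular X r) (hm : r ∈ maximalIdeal R)
    (k : ℕ) [Subsingleton (ExtMod R (QuotSMulTop r X) W (k + 1))] :
    Subsingleton (ExtMod R X W k) := by
  have : Module.Finite R (ExtMod R X W k) := ModuleCat.finite_ext R _ _ k
  have hsurj : Surjective (extMap W (r • LinearMap.id : X →ₗ[R] X) k) :=
    (LinearMap.surjective_iff_eq_zero_of_exact (exact_extMap_extConn W
      (f := LinearMap.lsmul R X r) hr (LinearMap.exact_lsmul_mkQ_smul_top X r)
      (Submodule.mkQ_surjective _) k)).mpr (Subsingleton.elim _ _)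
  rw [extMap_smul, extMap_id] at hsurj
  refine subsingleton_of_smul_top_eq_top (I := Ideal.span {r})
    ((Ideal.span_singleton_le_iff_mem _).mpr hm) (eq_top_iff.mpr fun x _ ↦ ?_)
  obtain ⟨y, rfl⟩ := hsurj x
  exact Submodule.smul_mem_smul (Ideal.mem_span_singleton_self r) trivial

lemma subsingleton_ext_of_isWeaklyRegular {d : ℕ}
    (hd : ∀ (Y : Type u) [AddCommGroup Y] [Module R Y] [Module.Finite R Y], ∀ i > d,
      Subsingleton (ExtMod R Y W i))
    {rs : List R} (hm : ∀ r ∈ rs, r ∈ maximalIdeal R) (hX : IsWeaklyRegular X rs) {i : ℕ}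
    (hi : d < i + rs.length) : Subsingleton (ExtMod R X W i) := by
  induction rs generalizing X i with
  | nil => exact hd X i hi
  | cons r rs ih =>
    rw [List.forall_mem_cons] at hm
    rw [isWeaklyRegular_cons_iff] at hX
    have := ih hm.2 hX.2 (i := i + 1) (by rw [List.length_cons] at hi; lia)
    exact subsingleton_ext_of_quotSMulTop hX.1 hm.1 i

end Nakayama

section InjectiveDimension

variable {R : Type u} [CommRing R] {W : Type u} [AddCommGroup W] [Module R W]

lemma subsingleton_ext_quot_ofList {rs : List R} {X : Type u} [AddCommGroup X] [Module R X]
    (hX : IsWeaklyRegular X rs) {k : ℕ} (hk : ∀ i > k, Subsingleton (ExtMod R X W i)) {i : ℕ}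
    (hi : k + rs.length < i) :
    Subsingleton (ExtMod R (X ⧸ (Ideal.ofList rs • ⊤ : Submodule R X)) W i) := by
  induction hX generalizing k with
  | nil X =>
    have := hk i hi
    exact (extCongr W (Submodule.quotEquivOfEqBot _
      (by rw [Ideal.ofList_nil, Submodule.bot_smul])) i).toEquiv.subsingleton
  | @cons X _ _ r rs hr _ ih =>
    have : Subsingleton (ExtMod R (QuotSMulTop r X ⧸ (Ideal.ofList rs • ⊤ : Submodule R _)) W i) :=
      ih (k := k + 1) (fun j hj ↦ by
        obtain ⟨j, rfl⟩ := Nat.exists_eq_add_one_of_ne_zero (Nat.ne_zero_of_lt hj)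
        have := hk j (Nat.lt_of_succ_lt_succ hj)
        have := hk (j + 1) (Nat.lt_of_succ_lt hj)
        exact subsingleton_ext_right (f := LinearMap.lsmul R X r) hr
          (LinearMap.exact_lsmul_mkQ_smul_top X r) (Submodule.mkQ_surjective _) j)
        (by rw [List.length_cons] at hi; lia)
    exact (extCongr W
      (Submodule.quotOfListConsSMulTopEquivQuotSMulTopInner X r rs) i).toEquiv.subsingleton

variable [IsLocalRing R]

instance : IsSimpleModule R (ResidueField R) :=
  isSimpleModule_iff_quot_maximal.mpr ⟨maximalIdeal R, inferInstance, ⟨.refl R _⟩⟩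

variable [IsNoetherianRing R]

lemma exists_residueField_injective {rs : List R} (hR : IsWeaklyRegular R rs)
    (hmax : ∀ r ∈ maximalIdeal R, ¬ IsWeaklyRegular R (rs ++ [r])) :
    ∃ f : ResidueField R →ₗ[R] (R ⧸ (Ideal.ofList rs • ⊤ : Submodule R R)), Injective f := by
  by_contra! hf
  have hsub : Subsingleton (ResidueField R →ₗ[R] (R ⧸ (Ideal.ofList rs • ⊤ : Submodule R R))) :=
    subsingleton_of_forall_eq 0 fun f ↦ f.injective_or_eq_zero.resolve_left (hf f)
  obtain ⟨r, hr, hreg⟩ := IsSMulRegular.subsingleton_linearMap_iff.mp hsub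
  rw [show Module.annihilator R (ResidueField R) = maximalIdeal R from Ideal.annihilator_quotient]
    at hr
  exact hmax r hr ((isWeaklyRegular_append_iff R rs [r]).mpr
    ⟨hR, (isWeaklyRegular_singleton_iff _ _).mpr hreg⟩)

lemma subsingleton_ext_residueField_of_succ {rs : List R} (hR : IsWeaklyRegular R rs)
    (hmax : ∀ r ∈ maximalIdeal R, ¬ IsWeaklyRegular R (rs ++ [r])) {c : ℕ} (hc : rs.length < c)
    (h : ∀ (Y : Type u) [AddCommGroup Y] [Module R Y] [Module.Finite R Y],
      Subsingleton (ExtMod R Y W (c + 1))) :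
    Subsingleton (ExtMod R (ResidueField R) W c) := by
  obtain ⟨f, hf⟩ := exists_residueField_injective hR hmax
  have := h ((R ⧸ (Ideal.ofList rs • ⊤ : Submodule R R)) ⧸ LinearMap.range f)
  have : Subsingleton (ExtMod R (R ⧸ (Ideal.ofList rs • ⊤ : Submodule R R)) W c) := by
    refine subsingleton_ext_quot_ofList hR (k := 0) (fun i hi ↦ ?_) (by rwa [zero_add])
    obtain ⟨i, rfl⟩ := Nat.exists_eq_add_one_of_ne_zero hi.ne'
    exact isHomAcyclic_of_projective R W R i
  exact subsingleton_ext_left hf (LinearMap.exact_map_mkQ_range f) (Submodule.mkQ_surjective _) c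

variable [Module.Finite R W]

lemma subsingleton_ext_of_residueField {c : ℕ} (hk : Subsingleton (ExtMod R (ResidueField R) W c))
    (h : ∀ (Y : Type u) [AddCommGroup Y] [Module R Y] [Module.Finite R Y],
      Subsingleton (ExtMod R Y W (c + 1)))
    (Y : Type u) [AddCommGroup Y] [Module R Y] [Module.Finite R Y] :
    Subsingleton (ExtMod R Y W c) := by
  induction ‹Module.Finite R Y› using
    IsNoetherianRing.induction_on_isQuotientEquivQuotientPrime R with
  | subsingleton Y => exact subsingleton_ext_of_subsingleton
  | quotient Y p e =>
    suffices Subsingleton (ExtMod R (R ⧸ p.asIdeal) W c) from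
      (extCongr W e c).toEquiv.subsingleton
    obtain hp | hp := (le_maximalIdeal p.isPrime.ne_top).eq_or_lt
    · exact hp ▸ hk
    · obtain ⟨r, hr, hrp⟩ := SetLike.exists_of_lt hp
      have hreg : IsSMulRegular (R ⧸ p.asIdeal) r := by
        rw [isSMulRegular_quotient_iff_mem_of_smul_mem]
        exact fun x hx ↦ (p.isPrime.mem_or_mem hx).resolve_left hrp
      have := h (QuotSMulTop r (R ⧸ p.asIdeal))
      exact subsingleton_ext_of_quotSMulTop hreg hr c
  | exact X Y Z f g hf hg hfg hX hZ => exact subsingleton_ext_middle hf hfg hg c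

/-- Bass' bound, by descending induction on `i`: the residue field embeds into `R / rs`, which has
projective dimension at most `rs.length`, so vanishing of `Ext^(i+1)` forces that of `Ext^i` on the
residue field and then, by prime filtrations, on every finite module. -/
theorem subsingleton_ext_of_finite_injectiveDimension {b : ℕ}
    (hb : HasInjectiveDimensionLE (ModuleCat.of R W) b) {rs : List R}
    (hR : IsWeaklyRegular R rs) (hmax : ∀ r ∈ maximalIdeal R, ¬ IsWeaklyRegular R (rs ++ [r]))
    (X : Type u) [AddCommGroup X] [Module R X] [Module.Finite R X] {i : ℕ} (hi : rs.length < i) :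
    Subsingleton (ExtMod R X W i) := by
  suffices descent : ∀ m c, b < c + m → rs.length < c → ∀ (Y : Type u) [AddCommGroup Y]
      [Module R Y] [Module.Finite R Y], Subsingleton (ExtMod R Y W c) from
    descent (b + 1) i (by lia) hi X
  intro m
  induction m with
  | zero =>
    intro c hc _ Y _ _ _
    exact HasInjectiveDimensionLT.subsingleton (ModuleCat.of R W) (b + 1) c hc _
  | succ m ih =>
    intro c hc hrs
    have hsucc := ih (c + 1) (by lia) (by lia)
    exact subsingleton_ext_of_residueField
      (subsingleton_ext_residueField_of_succ hR hmax hrs hsucc) hsucc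

end InjectiveDimension

section FiniteLength

variable {R : Type u} [CommRing R]

lemma surjective_of_injective_of_length_eq {X Y : Type*} [AddCommGroup X] [Module R X]
    [AddCommGroup Y] [Module R Y] (hY : IsFiniteLength R Y) {f : X →ₗ[R] Y} (hf : Injective f)
    (h : Module.length R X = Module.length R Y) : Surjective f := by
  obtain ⟨_, _⟩ := isFiniteLength_iff_isNoetherian_isArtinian.mp hY
  refine LinearMap.range_eq_top.mp (by_contra fun hne ↦ (Submodule.length_lt hne).ne ?_)
  rw [← (LinearEquiv.ofInjective f hf).length_eq, h]

lemma isFiniteLength_quot_smul_top {I : Ideal R} [IsNoetherianRing R] [IsArtinianRing (R ⧸ I)]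
    (X : Type*) [AddCommGroup X] [Module R X] [Module.Finite R X] :
    IsFiniteLength R (X ⧸ (I • ⊤ : Submodule R X)) := by
  have : Module.Finite (R ⧸ I) (X ⧸ (I • ⊤ : Submodule R X)) := .of_restrictScalars_finite R _ _
  exact isFiniteLength_iff_isNoetherian_isArtinian.mpr ⟨inferInstance,
    isArtinian_of_surjective_algebraMap (R := R ⧸ I) Ideal.Quotient.mk_surjective⟩

lemma smul_quot_ofList_eq_zero {rs : List R} {X : Type*} [AddCommGroup X] [Module R X] {r : R}
    (hr : r ∈ rs) (x : X ⧸ (Ideal.ofList rs • ⊤ : Submodule R X)) : r • x = 0 := by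
  obtain ⟨x, rfl⟩ := Submodule.mkQ_surjective _ x
  exact (Submodule.Quotient.mk_eq_zero _).mpr
    (Submodule.smul_mem_smul (Ideal.subset_span hr) trivial)

/-- Linear maps which vanish on a submodule are linear maps on the quotient. -/
def homQuotEquiv {X V : Type*} [AddCommGroup X] [Module R X] [AddCommGroup V] [Module R V]
    (p : Submodule R X) (h : ∀ φ : X →ₗ[R] V, p ≤ LinearMap.ker φ) :
    (X ⧸ p →ₗ[R] V) ≃ₗ[R] (X →ₗ[R] V) :=
  .ofBijective (p.mkQ.lcomp R V) ⟨LinearMap.lcomp_injective_of_surjective _ p.mkQ_surjective,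
    fun φ ↦ ⟨p.liftQ φ (h φ), p.liftQ_mkQ φ (h φ)⟩⟩

end FiniteLength

section Dualizing

variable {R : Type u} [CommRing R] [IsLocalRing R]

/-- A finite module `W` behaves, with respect to a sequence `rs` in the maximal ideal, like the
canonical module of a Cohen-Macaulay local ring with system of parameters `rs`. -/
structure IsDualizing (W : Type u) [AddCommGroup W] [Module R W] (rs : List R) : Prop where
  finite : Module.Finite R W
  ofList_le_maximalIdeal : Ideal.ofList rs ≤ maximalIdeal R
  isArtinianRing : IsArtinianRing (R ⧸ Ideal.ofList rs)
  isWeaklyRegular : IsWeaklyRegular W rs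
  subsingleton_ext : ∀ (Y : Type u) [AddCommGroup Y] [Module R Y] [Module.Finite R Y],
    ∀ i > rs.length, Subsingleton (ExtMod R Y W i)
  length_ext_residueField : Module.length R (ExtMod R (ResidueField R) W rs.length) = 1

namespace IsDualizing

variable {W : Type u} [AddCommGroup W] [Module R W] {rs : List R} (hW : IsDualizing W rs)

section FiniteLength

variable {L : Type u} [AddCommGroup L] [Module R L] (hfl : IsFiniteLength R L)
  (hL : ∀ r ∈ rs, ∀ x : L, r • x = 0)

include hW hfl hL

lemma length_ext : Module.length R (ExtMod R L W rs.length) = Module.length R L := by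
  induction hfl with
  | of_subsingleton =>
    have : Subsingleton (ExtMod R ‹_› W rs.length) := subsingleton_ext_of_subsingleton
    rw [Module.length_eq_zero, Module.length_eq_zero]
  | @of_simple_quotient L _ _ N hs _ ih =>
    obtain ⟨I, hI, ⟨e⟩⟩ := isSimpleModule_iff_quot_maximal.mp hs
    obtain rfl := eq_maximalIdeal hI
    have hi := N.injective_subtype
    have hex : Exact N.subtype N.mkQ := LinearMap.exact_subtype_mkQ N
    have hsu := N.mkQ_surjective
    have hN (r) (hr : r ∈ rs) (x : N) : r • x = 0 := Subtype.ext (hL r hr x)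
    have hinj : Injective (extMap W N.mkQ rs.length) := extMap_injective W hi hex hsu fun i hi ↦
      subsingleton_ext_of_lt_length hW.isWeaklyRegular hN hi
    have hsurj : Surjective (extMap W N.subtype rs.length) := by
      have := hW.subsingleton_ext (L ⧸ N) (rs.length + 1) (Nat.lt_succ_self _)
      exact (LinearMap.surjective_iff_eq_zero_of_exact
        (exact_extMap_extConn W hi hex hsu rs.length)).mpr (Subsingleton.elim _ _)
    rw [Module.length_eq_add_of_exact _ _ hinj hsurj (exact_extMap_extMap W hi hex hsu _),
      Module.length_eq_add_of_exact _ _ hi hsu hex, ih hN, Module.length_eq_one R (L ⧸ N),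
      (extCongr W e rs.length).length_eq.trans hW.length_ext_residueField, add_comm]

lemma length_hom : Module.length R (L →ₗ[R] W ⧸ (Ideal.ofList rs • ⊤ : Submodule R W)) =
    Module.length R L := by
  obtain ⟨e⟩ := nonempty_ext_length_equiv hW.isWeaklyRegular hL
  rw [← e.length_eq, hW.length_ext hfl hL]

lemma injective_applyₗ : Injective (LinearMap.applyₗ : L →ₗ[R]
    (L →ₗ[R] W ⧸ (Ideal.ofList rs • ⊤ : Submodule R W)) →ₗ[R]
      W ⧸ (Ideal.ofList rs • ⊤ : Submodule R W)) := by
  obtain ⟨_, _⟩ := isFiniteLength_iff_isNoetherian_isArtinian.mp hfl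
  set K := LinearMap.ker (LinearMap.applyₗ : L →ₗ[R]
    (L →ₗ[R] W ⧸ (Ideal.ofList rs • ⊤ : Submodule R W)) →ₗ[R] _)
  have hlength : Module.length R (L ⧸ K) = Module.length R L := by
    rw [← hW.length_hom hfl hL, ← (homQuotEquiv K fun φ x hx ↦ LinearMap.congr_fun hx φ).length_eq,
      hW.length_hom (hfl.of_surjective K.mkQ_surjective) fun r hr x ↦ ?_]
    obtain ⟨x, rfl⟩ := K.mkQ_surjective x
    rw [← map_smul, hL r hr, map_zero]
  exact LinearMap.ker_eq_bot.mp (by_contra fun hK ↦ (Submodule.length_quotient_lt K hK).ne hlength)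

end FiniteLength

variable [IsNoetherianRing R] {X : Type u} [AddCommGroup X] [Module R X] [Module.Finite R X]

include hW

lemma isHomAcyclic {xs : List R} (hm : ∀ x ∈ xs, x ∈ maximalIdeal R) (hX : IsWeaklyRegular X xs)
    (hxs : xs.length = rs.length) : IsHomAcyclic R W X := fun k ↦
  have := hW.finite
  subsingleton_ext_of_isWeaklyRegular hW.subsingleton_ext hm hX (by lia)

variable (hX : IsHomAcyclic R W X)

include hX

lemma isHomAcyclic_hom : IsHomAcyclic R W (X →ₗ[R] W) :=
  have := hW.finite
  hW.isHomAcyclic (fun _ hr ↦ hW.ofList_le_maximalIdeal (Ideal.subset_span hr))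
    (hX.isWeaklyRegular_hom hW.isWeaklyRegular) rfl

lemma length_hom_quot :
    Module.length R ((X →ₗ[R] W) ⧸ (Ideal.ofList rs • ⊤ : Submodule R (X →ₗ[R] W))) =
      Module.length R (X ⧸ (Ideal.ofList rs • ⊤ : Submodule R X)) := by
  have := hW.isArtinianRing
  obtain ⟨e⟩ := hX.nonempty_hom_quot_equiv hW.isWeaklyRegular
  rw [e.length_eq, ← hW.length_hom (isFiniteLength_quot_smul_top X)
    fun _ hr ↦ smul_quot_ofList_eq_zero hr]
  refine (homQuotEquiv _ fun φ ↦ Submodule.smul_le.mpr fun r hr x _ ↦ ?_).length_eq.symm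
  rw [LinearMap.mem_ker, map_smul]
  obtain ⟨w, hw⟩ := Submodule.mkQ_surjective _ (φ x)
  rw [← hw, ← map_smul]
  exact (Submodule.Quotient.mk_eq_zero _).mpr (Submodule.smul_mem_smul hr trivial)

/-- The evaluation map is an isomorphism modulo `rs`: functionals with values in `W / rs W` lift to
`W` and separate the points of `X / rs X`, and both sides have the same length. -/
theorem bijective_applyₗ :
    Bijective (LinearMap.applyₗ : X →ₗ[R] (X →ₗ[R] W) →ₗ[R] W) := by
  have := hW.finite
  have := hW.isArtinianRing
  have hX' := hW.isHomAcyclic_hom hX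
  refine bijective_of_bijective_mapQ hW.ofList_le_maximalIdeal
    (hX'.isWeaklyRegular_hom hW.isWeaklyRegular) ?_
  suffices hinj : Injective (Submodule.mapQ _ _ (LinearMap.applyₗ : X →ₗ[R] (X →ₗ[R] W) →ₗ[R] W)
      (Submodule.smul_top_le_comap_smul_top (Ideal.ofList rs) _)) from
    ⟨hinj, surjective_of_injective_of_length_eq (isFiniteLength_quot_smul_top _) hinj
      ((hW.length_hom_quot hX').trans (hW.length_hom_quot hX)).symm⟩
  refine (injective_iff_map_eq_zero _).mpr fun x hx ↦
    (injective_iff_map_eq_zero _).mp (hW.injective_applyₗ (isFiniteLength_quot_smul_top X)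
      fun _ hr ↦ smul_quot_ofList_eq_zero hr) x ?_
  obtain ⟨x, rfl⟩ := Submodule.mkQ_surjective _ x
  ext ψ
  obtain ⟨φ, hφ⟩ := hX.mkQ_compRight_surjective hW.isWeaklyRegular
    (ψ ∘ₗ (Ideal.ofList rs • (⊤ : Submodule R X)).mkQ)
  refine (LinearMap.congr_fun hφ x).symm.trans ?_
  exact (congr_arg (Submodule.mapQ _ _ (LinearMap.applyₗ φ)
    (Submodule.smul_top_le_comap_smul_top (Ideal.ofList rs) _)) hx).trans (map_zero _)

end IsDualizing

end Dualizing

section Depth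

variable {R : Type u} [CommRing R] [IsLocalRing R]

lemma length_le_depth {M : Type u} [AddCommGroup M] [Module R M] {rs : List R}
    (hm : ∀ r ∈ rs, r ∈ maximalIdeal R) (hrs : IsWeaklyRegular M rs) :
    (rs.length : ℕ∞) ≤ depth R M :=
  le_iSup₂_of_le rs hm (le_iSup_of_le hrs le_rfl)

lemma exists_isWeaklyRegular_of_depth_eq {M : Type u} [AddCommGroup M] [Module R M] {d : ℕ}
    (h : depth R M = d) :
    ∃ rs : List R, rs.length = d ∧ (∀ r ∈ rs, r ∈ maximalIdeal R) ∧ IsWeaklyRegular M rs := by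
  by_contra! hne
  have hlt (rs : List R) (hm : ∀ r ∈ rs, r ∈ maximalIdeal R) (hrs : IsWeaklyRegular M rs) :
      rs.length < d := by
    have hle := length_le_depth hm hrs
    rw [h, Nat.cast_le] at hle
    exact hle.lt_of_ne fun he ↦ hne rs he hm hrs
  have hd : 0 < d := hlt [] (fun _ hr ↦ (List.not_mem_nil hr).elim) (.nil R M)
  have hle : depth R M ≤ (d - 1 : ℕ) := iSup₂_le fun rs hm ↦ iSup_le fun hrs ↦
    Nat.cast_le.mpr (Nat.le_sub_one_of_lt (hlt rs hm hrs))
  rw [h, Nat.cast_le] at hle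
  lia

end Depth

section CommonSequence

variable {R : Type u} [CommRing R]

lemma isWeaklyRegular_of_leftInverse {X Z : Type*} [AddCommGroup X] [Module R X] [AddCommGroup Z]
    [Module R Z] {rs : List R} {i : X →ₗ[R] Z} {p : Z →ₗ[R] X} (h : p ∘ₗ i = LinearMap.id)
    (hZ : IsWeaklyRegular Z rs) : IsWeaklyRegular X rs := by
  induction rs generalizing X Z with
  | nil => exact .nil R X
  | cons r rs ih =>
    rw [isWeaklyRegular_cons_iff] at hZ ⊢
    exact ⟨hZ.1.of_injective i (LeftInverse.injective (LinearMap.congr_fun h)),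
      ih (by rw [← QuotSMulTop.map_comp, h, QuotSMulTop.map_id]) hZ.2⟩

lemma subsingleton_ext_prod {X U V : Type u} [AddCommGroup X] [Module R X] [AddCommGroup U]
    [Module R U] [AddCommGroup V] [Module R V] {i : ℕ} [Subsingleton (ExtMod R X U i)]
    [Subsingleton (ExtMod R X V i)] : Subsingleton (ExtMod R X (U × V) i) :=
  subsingleton_of_forall_eq 0 fun x ↦ by
    obtain ⟨y, rfl⟩ := (exact_extMapRight_extMapRight X (LinearMap.inl_injective (R := R))
      Exact.inl_snd LinearMap.snd_surjective i x).mp (Subsingleton.elim (α := ExtMod R X V i) _ _)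
    rw [Subsingleton.elim y 0, map_zero]

variable [IsLocalRing R] [IsNoetherianRing R]

lemma exists_isWeaklyRegular_prod {X Y : Type u} [AddCommGroup X] [Module R X] [Module.Finite R X]
    [AddCommGroup Y] [Module R Y] [Module.Finite R Y] [Nontrivial Y] {xs ys : List R}
    (hxm : ∀ x ∈ xs, x ∈ maximalIdeal R) (hxs : IsWeaklyRegular X xs)
    (hym : ∀ y ∈ ys, y ∈ maximalIdeal R) (hys : IsWeaklyRegular Y ys)
    (h : xs.length = ys.length) :
    ∃ rs : List R, rs.length = xs.length ∧ (∀ r ∈ rs, r ∈ maximalIdeal R) ∧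
      IsWeaklyRegular X rs ∧ IsWeaklyRegular Y rs := by
  have hk (r : R) (hr : r ∈ maximalIdeal R) (z : ResidueField R) : r • z = 0 := by
    rw [Algebra.smul_def, ResidueField.algebraMap_eq, (residue_eq_zero_iff r).mpr hr, zero_mul]
  have hne : maximalIdeal R • (⊤ : Submodule R (X × Y)) ≠ ⊤ :=
    (Submodule.top_ne_ideal_smul_of_le_jacobson_annihilator (maximalIdeal_le_jacobson _)).symm
  have hsupport : Module.support R (ResidueField R) = PrimeSpectrum.zeroLocus (maximalIdeal R) := by
    rw [Module.support_eq_zeroLocus]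
    exact congr_arg _ (congr_arg _ (Ideal.annihilator_quotient (I := maximalIdeal R)))
  obtain ⟨rs, hl, hm, hrs⟩ := ModuleCat.exists_isRegular_of_exists_subsingleton_ext
    (maximalIdeal R) xs.length (ModuleCat.of R (X × Y)) hne.lt_top
    (ModuleCat.of R (ResidueField R)) hsupport fun i hi ↦ by
      have : Subsingleton (ExtMod R (ResidueField R) X i) :=
        subsingleton_ext_of_lt_length hxs (fun r hr ↦ hk r (hxm r hr)) hi
      have : Subsingleton (ExtMod R (ResidueField R) Y i) :=
        subsingleton_ext_of_lt_length hys (fun r hr ↦ hk r (hym r hr)) (h ▸ hi)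
      exact subsingleton_ext_prod
  exact ⟨rs, hl, hm,
    isWeaklyRegular_of_leftInverse (LinearMap.fst_comp_inl R X Y) hrs.toIsWeaklyRegular,
    isWeaklyRegular_of_leftInverse (LinearMap.snd_comp_inr R X Y) hrs.toIsWeaklyRegular⟩

end CommonSequence

section Canonical

variable {R : Type u} [CommRing R] [IsLocalRing R]

lemma exists_ringKrullDim_eq [IsNoetherianRing R] : ∃ d : ℕ, ringKrullDim R = d := by
  have h := finiteRingKrullDim_iff_ne_bot_and_top.mp (inferInstance : FiniteRingKrullDim R)
  obtain ⟨x, hx⟩ := WithBot.ne_bot_iff_exists.mp h.1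
  rw [← hx] at h ⊢
  obtain ⟨d, rfl⟩ := ENat.ne_top_iff_exists.mp (fun hx : x = ⊤ ↦ h.2 (by rw [hx]; rfl))
  exact ⟨d, rfl⟩

lemma isArtinianRing_quot_ofList [IsNoetherianRing R] {rs : List R}
    (hm : ∀ r ∈ rs, r ∈ maximalIdeal R) (hR : IsWeaklyRegular R rs)
    (hdim : ringKrullDim R = rs.length) : IsArtinianRing (R ⧸ Ideal.ofList rs) := by
  refine isArtinianRing_iff_isNoetherianRing_krullDimLE_zero.mpr ⟨inferInstance, ?_⟩
  have h := (ringKrullDim_add_length_eq_ringKrullDim_of_isRegular rs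
    (.of_isWeaklyRegular_of_mem_maximalIdeal R hm hR)).trans (hdim.trans (zero_add _).symm)
  exact Ring.krullDimLE_iff.mpr (ENat.WithBot.add_natCast_cancel.mp h).le

lemma IsCanonicalModule.exists_isDualizing (hR : IsCohenMacaulayLocalRing R) {W : Type u}
    [AddCommGroup W] [Module R W] (hW : IsCanonicalModule R W) :
    ∃ rs : List R, ringKrullDim R = rs.length ∧ IsDualizing W rs := by
  have := hR.noetherian
  have := hW.maximalCohenMacaulay.finite
  obtain ⟨d, hdim⟩ := exists_ringKrullDim_eq (R := R)
  have hdR : depth R R = d := WithBot.coe_injective (hR.depth_eq.trans hdim)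
  have hdW : depth R W = d := WithBot.coe_injective (hW.maximalCohenMacaulay.depth_eq.trans hdim)
  obtain ⟨xs, hxl, hxm, hxs⟩ := exists_isWeaklyRegular_of_depth_eq hdW
  obtain ⟨ys, hyl, hym, hys⟩ := exists_isWeaklyRegular_of_depth_eq hdR
  obtain ⟨rs, hl, hm, hWrs, hRrs⟩ :=
    exists_isWeaklyRegular_prod hxm hxs hym hys (hxl.trans hyl.symm)
  obtain rfl : rs.length = d := hl.trans hxl
  have hmax (r : R) (hr : r ∈ maximalIdeal R) : ¬ IsWeaklyRegular R (rs ++ [r]) := fun h ↦ by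
    have hle := length_le_depth
      (List.forall_mem_append.mpr ⟨hm, List.forall_mem_singleton.mpr hr⟩) h
    rw [hdR, Nat.cast_le, List.length_append, List.length_singleton] at hle
    lia
  obtain ⟨b, hb⟩ := hW.finite_injectiveDimension
  have htype := hW.type_eq_one
  rw [moduleType, hdW, ENat.toNat_natCast] at htype
  exact ⟨rs, hdim, ‹_›, Ideal.span_le.mpr hm, isArtinianRing_quot_ofList hm hRrs hdim, hWrs,
    fun Y _ _ _ i hi ↦ subsingleton_ext_of_finite_injectiveDimension hb hRrs hmax Y hi, htype⟩

namespace IsMaximalCohenMacaulay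

variable (hR : IsCohenMacaulayLocalRing R) {W : Type u} [AddCommGroup W] [Module R W]
  (hW : IsCanonicalModule R W) {X : Type u} [AddCommGroup X] [Module R X]
  (hX : IsMaximalCohenMacaulay R X)

include hR hW hX

lemma isHomAcyclic : IsHomAcyclic R W X := by
  have := hR.noetherian
  have := hX.finite
  obtain ⟨rs, hdim, hrs⟩ := hW.exists_isDualizing hR
  obtain ⟨xs, hl, hm, hxs⟩ := exists_isWeaklyRegular_of_depth_eq
    (WithBot.coe_injective (hX.depth_eq.trans hdim))
  exact hrs.isHomAcyclic hm hxs hl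

lemma isHomAcyclic_hom : IsHomAcyclic R W (X →ₗ[R] W) := by
  have := hR.noetherian
  have := hX.finite
  obtain ⟨rs, -, hrs⟩ := hW.exists_isDualizing hR
  exact hrs.isHomAcyclic_hom (hX.isHomAcyclic hR hW)

lemma nonempty_equiv_bidual : Nonempty (X ≃ₗ[R] ((X →ₗ[R] W) →ₗ[R] W)) := by
  have := hR.noetherian
  have := hX.finite
  obtain ⟨rs, -, hrs⟩ := hW.exists_isDualizing hR
  exact ⟨.ofBijective _ (hrs.bijective_applyₗ (hX.isHomAcyclic hR hW))⟩

end IsMaximalCohenMacaulay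

end Canonical

end CanonicalDuality

end

theorem theorem2p1_general (R : Type u) [CommRing R] [IsLocalRing R]
    (hR : CanonicalDuality.IsCohenMacaulayLocalRing R)
    (ω : Type u) [AddCommGroup ω] [Module R ω] (hω : CanonicalDuality.IsCanonicalModule R ω)
    (M : Type u) [AddCommGroup M] [Module R M]
    (N : Type u) [AddCommGroup N] [Module R N]
    (hN : CanonicalDuality.IsMaximalCohenMacaulay R N)
    (n : ℕ)
    (hTor : ∀ j < n, Subsingleton (CanonicalDuality.TorMod R M (N →ₗ[R] ω) j) ∨
      CanonicalDuality.IsMaximalCohenMacaulay R (CanonicalDuality.TorMod R M (N →ₗ[R] ω) j)) :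
    (∀ j ≤ n, Nonempty (CanonicalDuality.ExtMod R M N j ≃ₗ[R]
      (CanonicalDuality.TorMod R M (N →ₗ[R] ω) j →ₗ[R] ω))) ∧
    (∀ j < n, Nonempty ((CanonicalDuality.ExtMod R M N j →ₗ[R] ω) ≃ₗ[R]
      CanonicalDuality.TorMod R M (N →ₗ[R] ω) j)) ∧
    ∃ (f₁ : CanonicalDuality.ExtMod R (CanonicalDuality.TorMod R M (N →ₗ[R] ω) n) ω 1 →ₗ[R]
          CanonicalDuality.ExtMod R M N (n + 1))
      (f₂ : CanonicalDuality.ExtMod R M N (n + 1) →ₗ[R]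
          (CanonicalDuality.TorMod R M (N →ₗ[R] ω) (n + 1) →ₗ[R] ω))
      (f₃ : (CanonicalDuality.TorMod R M (N →ₗ[R] ω) (n + 1) →ₗ[R] ω) →ₗ[R]
          CanonicalDuality.ExtMod R (CanonicalDuality.TorMod R M (N →ₗ[R] ω) n) ω 2)
      (f₄ : CanonicalDuality.ExtMod R (CanonicalDuality.TorMod R M (N →ₗ[R] ω) n) ω 2 →ₗ[R]
          CanonicalDuality.ExtMod R M N (n + 2)),
      Function.Injective f₁ ∧ Function.Exact f₁ f₂ ∧ Function.Exact f₂ f₃ ∧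
        Function.Exact f₃ f₄ := by
  have hacyclic : ∀ j < n, CanonicalDuality.IsHomAcyclic R ω
      (CanonicalDuality.TorMod R M (N →ₗ[R] ω) j) := fun j hj ↦
    (hTor j hj).elim (fun _ _ ↦ CanonicalDuality.subsingleton_ext_of_subsingleton)
      (·.isHomAcyclic hR hω)
  obtain ⟨e⟩ := hN.nonempty_equiv_bidual hR hω
  have hdual := hN.isHomAcyclic_hom hR hω
  refine ⟨fun j ↦ CanonicalDuality.nonempty_ext_equiv_dual_tor e hdual hacyclic, fun j hj ↦ ?_,
    CanonicalDuality.exists_fiveTerm_exact_ext_tor e hdual hacyclic⟩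
  obtain ⟨ε⟩ := CanonicalDuality.nonempty_ext_equiv_dual_tor e hdual hacyclic hj.le
  obtain hzero | hmcm := hTor j hj
  · have := ε.toEquiv.subsingleton
    exact ⟨0⟩
  · obtain ⟨b⟩ := hmcm.nonempty_equiv_bidual hR hω
    exact ⟨LinearEquiv.congrLeft ω R ε ≪≫ₗ b.symm⟩

theorem theorem2p1 (R : Type u) [CommRing R] [IsLocalRing R]
    (hR : CanonicalDuality.IsCohenMacaulayLocalRing R)
    (ω : Type u) [AddCommGroup ω] [Module R ω] (hω : CanonicalDuality.IsCanonicalModule R ω)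
    (M : Type u) [AddCommGroup M] [Module R M] [Module.Finite R M]
    (N : Type u) [AddCommGroup N] [Module R N]
    (hN : CanonicalDuality.IsMaximalCohenMacaulay R N)
    (n : ℕ) (hn : 1 ≤ n)
    (hTor : ∀ j < n, Subsingleton (CanonicalDuality.TorMod R M (N →ₗ[R] ω) j) ∨
      CanonicalDuality.IsMaximalCohenMacaulay R (CanonicalDuality.TorMod R M (N →ₗ[R] ω) j)) :
    (∀ j ≤ n, Nonempty (CanonicalDuality.ExtMod R M N j ≃ₗ[R]
      (CanonicalDuality.TorMod R M (N →ₗ[R] ω) j →ₗ[R] ω))) ∧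
    (∀ j < n, Nonempty ((CanonicalDuality.ExtMod R M N j →ₗ[R] ω) ≃ₗ[R]
      CanonicalDuality.TorMod R M (N →ₗ[R] ω) j)) ∧
    ∃ (f₁ : CanonicalDuality.ExtMod R (CanonicalDuality.TorMod R M (N →ₗ[R] ω) n) ω 1 →ₗ[R]
          CanonicalDuality.ExtMod R M N (n + 1))
      (f₂ : CanonicalDuality.ExtMod R M N (n + 1) →ₗ[R]
          (CanonicalDuality.TorMod R M (N →ₗ[R] ω) (n + 1) →ₗ[R] ω))
      (f₃ : (CanonicalDuality.TorMod R M (N →ₗ[R] ω) (n + 1) →ₗ[R] ω) →ₗ[R]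
          CanonicalDuality.ExtMod R (CanonicalDuality.TorMod R M (N →ₗ[R] ω) n) ω 2)
      (f₄ : CanonicalDuality.ExtMod R (CanonicalDuality.TorMod R M (N →ₗ[R] ω) n) ω 2 →ₗ[R]
          CanonicalDuality.ExtMod R M N (n + 2)),
      Function.Injective f₁ ∧ Function.Exact f₁ f₂ ∧ Function.Exact f₂ f₃ ∧
        Function.Exact f₃ f₄ :=
  theorem2p1_general R hR ω hω M N hN n hTor
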